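/- Let $\|\cdot\|$ denote the $\ell^1$ norm on $\mathbb{Z}^d$ and regard $\mathbb{Z}^d$ as the nearest-neighbour graph ($x\sim y$ iff $\|x-y\|=1$). Let $\Gamma\subset\mathbb{Z}^d$ and $V_0:\mathbb{Z}^d\to\mathbb{R}$ both be invariant under translations by a subgroup of $\mathbb{Z}^d$ of finite index. Let $\mu$ be a probability measure on $\mathbb{R}$ such that * for some $\alpha>0$ and $K<\infty$, $\mu[t-\epsilon,t+\epsilon]\le K\epsilon^\alpha$ for all $\epsilon>0$, $t\in\mathbb{R}$; * $\int|t|^q\,d\mu(t)<\infty$ for some $q>0$. Let $V(v)$, $v\in\Gamma$, be independent random variables with common distribution $\mu$, and put $V(v)=0$ for $v\notin\Gamma$. For $g\ge 0$ let $H(g)=-\Delta+V_0+gV$ be the self-adjoint operator on $\ell^2(\mathbb{Z}^d)$ given by $$[H(g)\psi](v)=\sum_{w\sim v}(\psi(v)-\psi(w))+(V_0(v)+gV(v))\psi(v),$$ and for $z\notin\mathbb{R}$ let $G_z[H](v,w)=\langle\delta_v,(H-z)^{-1}\delta_w\rangle$. Let $g>0$ be arbitrary, and assume that all connected components of $\mathbb{Z}^d\setminus\Gamma$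 are finite. Fix $x\in\mathbb{Z}^d$ and $\lambda\in\mathbb{R}$, and suppose that there exist finite sets $B_n\subset\mathbb{Z}^d$ inducing connected subgraphs, numbers $R_n>0$ with $R_n\to\infty$, and constants $C,c>0$ such that, with $B(x,R)=\{y\in\mathbb{Z}^d:\|y-x\|\le R\}$, $P_{B_n}:\ell^2(\mathbb{Z}^d)\to\ell^2(B_n)$ the coordinate projection, $H_n(0)=P_{B_n}H(0)P_{B_n}^*$, and $\mathbf{P}_{\{\lambda\}}[H_n(0)]$ the orthogonal projection of $\ell^2(B_n)$ onto the eigenspace of $H_n(0)$ at $\lambda$, for every $n$: 1. $B(x,R_n)\subset B_n\subset B(x,R_n^C)$ and $R_n<R_{n+1}<R_n^C$; 2. there exists $y\in B_n$ with $\|x-y\|\ge R_n^c$ and $\left|\mathbf{P}_{\{\lambda\}}[H_n(0)](x,y)\right|\ge R_n^{-C}$; 3. every vector in the range of $\mathbf{P}_{\{\lambda\}}[H_n(0)]$ vanishes on $\Gamma\cap B_n$; 4. $|\lambda'-\lambda|\ge R_n^{-C}$ for every $\lambda'\in\sigma(H_n(0))\setminus\{\lambda\}$. Then there exists $p_0$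 such that for all $p\ge p_0$ $$\lim_{\epsilon\to+0}\ \sum_{y\in\mathbb{Z}^d}\epsilon^2\,\mathbb{E}\left|G_{\lambda+i\epsilon}[H(g)](x,y)\right|^2\|x-y\|^p=\infty .$$ -/

import Mathlib

open Filter Topology MeasureTheory ProbabilityTheory
open scoped ENNReal

namespace TrimmedAnderson

/-- The sites of the lattice `ℤ^d`. -/
abbrev Site (d : ℕ) : Type := Fin d → ℤ

/-- The `ℓ¹` distance on `ℤ^d`, which is the graph distance of the lattice. -/
def dist1 {d : ℕ} (x y : Site d) : ℕ := ∑ i, (x i - y i).natAbs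

theorem dist1_comm {d : ℕ} (x y : Site d) : dist1 x y = dist1 y x := by
  refine Finset.sum_congr rfl fun i _ => ?_
  omega

/-- The nearest-neighbour graph of `ℤ^d`. -/
def latticeGraph (d : ℕ) : SimpleGraph (Site d) where
  Adj x y := dist1 x y = 1
  symm := ⟨fun x y h => by rw [dist1_comm]; exact h⟩
  loopless := ⟨fun x h => by simp [dist1] at h⟩

/-- The formal Schrödinger operator `-Δ + U` on all functions `ψ : ℤ^d → ℂ`,
`ψ ↦ (x ↦ ∑_{y ∼ x} (ψ x - ψ y) + U x * ψ x)`; the neighbours of `x` are the sites `x ± e_i`. -/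
def formalOp {d : ℕ} (U : Site d → ℝ) : (Site d → ℂ) →ₗ[ℂ] (Site d → ℂ) where
  toFun ψ x :=
    ∑ i : Fin d, ((ψ x - ψ (x + Pi.single i 1)) + (ψ x - ψ (x - Pi.single i 1)))
      + (U x : ℂ) * ψ x
  map_add' ψ φ := by
    funext x
    simp only [Pi.add_apply]
    rw [mul_add, add_add_add_comm, ← Finset.sum_add_distrib]
    congr 1
    exact Finset.sum_congr rfl fun i _ => by ring
  map_smul' a ψ := by
    funext x
    simp only [Pi.smul_apply, smul_eq_mul, RingHom.id_apply]
    rw [mul_add, Finset.mul_sum]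
    congr 1
    · exact Finset.sum_congr rfl fun i _ => by ring
    · ring

/-- The Hilbert space `ℓ²(ℤ^d)`. -/
abbrev Hilb (d : ℕ) : Type := lp (fun _ : Site d => ℂ) 2

/-- The Schrödinger operator `-Δ + U` as a (possibly unbounded) operator on `ℓ²(ℤ^d)`, with its
natural domain `{ψ ∈ ℓ² : (-Δ + U) ψ ∈ ℓ²}`, on which it is self-adjoint. -/
noncomputable def schrodinger {d : ℕ} (U : Site d → ℝ) : Hilb d →ₗ.[ℂ] Hilb d where
  domain :=
    { carrier := {ψ | Memℓp (formalOp U (ψ : Site d → ℂ)) 2}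
      add_mem' := by
        intro ψ φ hψ hφ
        have h := Memℓp.add hψ hφ
        simp only [Set.mem_ofPred_eq, lp.coeFn_add, map_add]
        exact h
      zero_mem' := by
        simp only [Set.mem_ofPred_eq, lp.coeFn_zero, map_zero]
        exact zero_memℓp
      smul_mem' := by
        intro a ψ hψ
        have h := Memℓp.const_smul hψ a
        simp only [Set.mem_ofPred_eq, lp.coeFn_smul, map_smul]
        exact h }
  toFun :=
    { toFun := fun ψ => ⟨formalOp U ((ψ : Hilb d) : Site d → ℂ), ψ.2⟩
      map_add' := by
        intro ψ φ
        ext x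
        exact congrFun (map_add (formalOp U) _ _) x
      map_smul' := by
        intro a ψ
        ext x
        exact congrFun (map_smul (formalOp U) _ _) x }

/-- `R` is the resolvent `(A - z)⁻¹` of the operator `A`: a bounded two-sided inverse of
`A - z : dom A → E`. -/
def IsResolventAt {E : Type*} [NormedAddCommGroup E] [NormedSpace ℂ E]
    (A : E →ₗ.[ℂ] E) (z : ℂ) (R : E →L[ℂ] E) : Prop :=
  (∀ φ : E, ∃ h : R φ ∈ A.domain, A ⟨R φ, h⟩ - z • R φ = φ) ∧
    ∀ ψ : A.domain, R (A ψ - z • (ψ : E)) = ψ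

theorem IsResolventAt.unique {E : Type*} [NormedAddCommGroup E] [NormedSpace ℂ E]
    {A : E →ₗ.[ℂ] E} {z : ℂ} {R S : E →L[ℂ] E}
    (hR : IsResolventAt A z R) (hS : IsResolventAt A z S) : R = S := by
  ext φ
  obtain ⟨h, e⟩ := hS.1 φ
  have := hR.2 ⟨S φ, h⟩
  rw [e] at this
  exact this

open Classical in
/-- The resolvent `G_z[A] = (A - z)⁻¹`, for `z` in the resolvent set of `A` (in particular for all
non-real `z` when `A` is self-adjoint); the value is `0` when `z` belongs to the spectrum. -/
noncomputable def resolventOp {E : Type*} [NormedAddCommGroup E] [NormedSpace ℂ E]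
    (A : E →ₗ.[ℂ] E) (z : ℂ) : E →L[ℂ] E :=
  if h : ∃ R, IsResolventAt A z R then h.choose else 0

/-- The Green function `G_z[-Δ + U](x, y) = ⟨δ_x, (-Δ + U - z)⁻¹ δ_y⟩`. -/
noncomputable def green {d : ℕ} (U : Site d → ℝ) (z : ℂ) (x y : Site d) : ℂ :=
  inner ℂ (lp.single 2 x (1 : ℂ) : Hilb d)
    (resolventOp (schrodinger U) z (lp.single 2 y (1 : ℂ) : Hilb d))

/-- The restriction `P_B (-Δ + U) P_B^*` to a finite set `B` of sites: extend by zero to `ℤ^d`,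
apply the operator, restrict to `B`. -/
noncomputable def restrictOp {d : ℕ} (U : Site d → ℝ) (B : Finset (Site d)) :
    Module.End ℂ (EuclideanSpace ℂ B) :=
  (WithLp.linearEquiv 2 ℂ (B → ℂ)).symm.toLinearMap ∘ₗ
    LinearMap.funLeft ℂ ℂ (Subtype.val : B → Site d) ∘ₗ
      formalOp U ∘ₗ
        Function.ExtendByZero.linearMap ℂ (Subtype.val : B → Site d) ∘ₗ
          (WithLp.linearEquiv 2 ℂ (B → ℂ)).toLinearMap

/-- The spectral projection `P_{λ}[P_B (-Δ + U) P_B^*]`: the orthogonal projection onto the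
eigenspace at `lam` (the zero projection if `lam` is not an eigenvalue). -/
noncomputable def spectralProj {d : ℕ} (U : Site d → ℝ) (B : Finset (Site d)) (lam : ℝ) :
    EuclideanSpace ℂ B →L[ℂ] EuclideanSpace ℂ B :=
  (Module.End.eigenspace (restrictOp U B) (lam : ℂ)).starProjection

/-- The matrix entry `P(x, y) = ⟨δ_x, P δ_y⟩` of an operator on `ℓ²(B)`. -/
noncomputable def entry {d : ℕ} {B : Finset (Site d)}
    (P : EuclideanSpace ℂ B →L[ℂ] EuclideanSpace ℂ B) (x y : B) : ℂ :=
  inner ℂ (EuclideanSpace.single x (1 : ℂ)) (P (EuclideanSpace.single y (1 : ℂ)))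

/-- `Γ` and `V₀` are invariant under translations by a finite-index subgroup of `ℤ^d`. -/
def IsPeriodic {d : ℕ} (Γ : Set (Site d)) (V₀ : Site d → ℝ) : Prop :=
  ∃ 𝒢 : AddSubgroup (Site d), 𝒢.FiniteIndex ∧
    ∀ t ∈ 𝒢, ∀ x, (x + t ∈ Γ ↔ x ∈ Γ) ∧ V₀ (x + t) = V₀ x

/-- `μ` is `α`-regular for some `α > 0`. -/
def IsRegular (μ : Measure ℝ) : Prop :=
  ∃ α > (0 : ℝ), ∃ K : ℝ, ∀ ε > (0 : ℝ), ∀ t : ℝ,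
    μ (Set.Icc (t - ε) (t + ε)) ≤ ENNReal.ofReal (K * ε ^ α)

/-- `μ` has a finite `q`-moment for some `q > 0`. -/
def HasFiniteMoment (μ : Measure ℝ) : Prop :=
  ∃ q > (0 : ℝ), ∫⁻ t, ENNReal.ofReal (|t| ^ q) ∂μ < ∞

/-- A random potential supported on `Γ`, whose values at the sites of `Γ` are independent with
common distribution `μ`. -/
structure IsTrimmedPotential {d : ℕ} {Ω : Type*} [MeasurableSpace Ω] (Pr : Measure Ω)
    (Γ : Set (Site d)) (μ : Measure ℝ) (V : Site d → Ω → ℝ) : Prop where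
  measurable : ∀ x ∈ Γ, Measurable (V x)
  law : ∀ x ∈ Γ, Pr.map (V x) = μ
  indep : iIndepFun (fun x : Γ => V x) Pr
  off : ∀ x ∉ Γ, ∀ ω, V x ω = 0

/-- The moment `∑_y ε² 𝔼 |G_{λ + iε}[H(g)](x, y)|² ‖x - y‖^p`, as an element of `[0, ∞]`, for
`H(g) = -Δ + V₀ + g V`. -/
noncomputable def greenMoment {d : ℕ} {Ω : Type*} [MeasurableSpace Ω] (Pr : Measure Ω)
    (V₀ : Site d → ℝ) (V : Site d → Ω → ℝ) (g lam : ℝ) (x : Site d) (p ε : ℝ) : ℝ≥0∞ :=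
  ∑' y : Site d, ENNReal.ofReal (ε ^ 2) *
    (∫⁻ ω, ‖green (fun v => V₀ v + g * V v ω) (lam + ε * Complex.I) x y‖ₑ ^ 2 ∂Pr) *
      ENNReal.ofReal ((dist1 x y : ℝ) ^ p)

end TrimmedAnderson

namespace TrimmedAnderson

/-! Put `w y = ε * G(x, y)` at energy `λ + iε`; it solves `(H(g) - λ - iε) w = ε δ_x`. Let `A` be
the restriction of `H(0)` to a box `B` of scale `r = R n`, and `P` its spectral projection at `λ`.
On `B` the equation reads `(A - λ) w = ε δ_x + iε w - gV w + s`, where `s` collects the values of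
`w` just outside `B`. Applying `P` kills the left side, and kills `gV w` because eigenfunctions at
`λ` vanish on `Γ`. Hence `P w = i P δ_x + (i/ε) P s`: up to the boundary term, `P w` is as large at
`y` as the spectral projection entry, at least `r^(-C)`.

By the spectral gap, `‖w - P w‖ ≤ r^C ‖(A - λ) w‖`, so it remains to see that `gV w` is small on `Γ
∩ B`. The Ward identity gives `|w v|² ≤ ε |G(v, v)|`, and a Wegner estimate (rank-one perturbation
and regularity of `μ`) keeps `|G(v, v)|` far below `1/ε`; the moment condition bounds `V`. Both hold
throughout `B` with probability at least `1/2` once `ε ≤ r^(-A)`. Then either `w` is not small at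
`y`, or the boundary term matters and `w` is not small somewhere outside `B`. In both cases `|w| ≥ ε
r^(-k₄)` at distance at least `r^(min c 1)` from `x`, and a large `p` outweighs the polynomial
losses. Since `R (n+1) < R n ^ C`, every small `ε` satisfies `r^(-CA) ≤ ε ≤ r^(-A)` at some scale.

The main steps are `norm_entry_le`, `im_mul_norm_green_sq_le`,
`IsTrimmedPotential.measure_le_norm_green_le`, `exists_le_norm_green` and
`ofReal_half_le_greenMoment`. -/

variable {d : ℕ}

/-! ### Self-adjointness of `-Δ + U` and its resolvent -/

theorem formalOp_apply (U : Site d → ℝ) (ψ : Site d → ℂ) (x : Site d) :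
    formalOp U ψ x = ∑ i : Fin d, ((ψ x - ψ (x + Pi.single i 1)) + (ψ x - ψ (x - Pi.single i 1)))
      + (U x : ℂ) * ψ x := rfl

theorem summable_norm_sq_of_memℓp {ψ : Site d → ℂ} (h : Memℓp ψ 2) : Summable fun x => ‖ψ x‖ ^ 2 := by
  have := (memℓp_gen_iff (p := 2) (by simp)).1 h
  simpa using this

theorem summable_mul_shift {φ ψ : Site d → ℂ} (hφ : Memℓp φ 2) (hψ : Memℓp ψ 2) (e : Site d) :
    Summable fun x => φ x * ψ (x + e) := by
  have h1 := summable_norm_sq_of_memℓp hφ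
  have h2 := (Equiv.addRight e).summable_iff.2 (summable_norm_sq_of_memℓp hψ)
  refine Summable.of_norm_bounded (h1.add h2) fun x => ?_
  simp only [Function.comp, Equiv.coe_addRight, norm_mul]
  nlinarith [sq_nonneg (‖φ x‖ - ‖ψ (x + e)‖), sq_nonneg ‖φ x‖, sq_nonneg ‖ψ (x + e)‖]

theorem hasSum_shift_sub {f : Site d → ℂ} (hf : Summable f) (e : Site d) :
    HasSum (fun x => f (x - e) - f x) 0 := by
  have h := hf.hasSum
  have h' : HasSum (fun x => f (x - e)) (∑' x, f x) := (Equiv.subRight e).hasSum_iff.2 h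
  simpa using h'.sub h

/-- Green's identity: the formal operator is symmetric for the bilinear pairing. -/
theorem hasSum_formalOp_symm (U : Site d → ℝ) {φ ψ : Site d → ℂ}
    (hφ : Memℓp φ 2) (hψ : Memℓp ψ 2) :
    HasSum (fun x => φ x * formalOp U ψ x - formalOp U φ x * ψ x) 0 := by
  -- The diagonal terms cancel; the hopping terms are differences of a summable function and its
  -- shift, so they sum to zero.
  have h : HasSum (fun x => ∑ i : Fin d,
      ((φ (x - Pi.single i 1) * ψ (x - Pi.single i 1 + Pi.single i 1) -
          φ x * ψ (x + Pi.single i 1)) -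
        (ψ (x - Pi.single i 1) * φ (x - Pi.single i 1 + Pi.single i 1) -
          ψ x * φ (x + Pi.single i 1)))) (∑ i : Fin d, ((0 : ℂ) - 0)) := by
    refine hasSum_sum fun i _ => ?_
    exact (hasSum_shift_sub (summable_mul_shift hφ hψ (Pi.single i 1)) _).sub
      (hasSum_shift_sub (summable_mul_shift hψ hφ (Pi.single i 1)) _)
  simp only [sub_zero, Finset.sum_const_zero] at h
  refine h.congr_fun fun x => ?_
  rw [formalOp_apply, formalOp_apply, mul_add, add_mul, Finset.mul_sum, Finset.sum_mul,
    add_sub_add_comm, ← Finset.sum_sub_distrib]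
  rw [show φ x * (U x * ψ x) - U x * φ x * ψ x = 0 by ring, add_zero]
  refine Finset.sum_congr rfl fun i _ => ?_
  simp only [sub_add_cancel]
  ring

theorem formalOp_conj (U : Site d → ℝ) (ψ : Site d → ℂ) (x : Site d) :
    formalOp U (fun y => starRingEnd ℂ (ψ y)) x = starRingEnd ℂ (formalOp U ψ x) := by
  simp [formalOp_apply]

theorem memℓp_conj {ψ : Site d → ℂ} (h : Memℓp ψ 2) :
    Memℓp (fun y => starRingEnd ℂ (ψ y)) 2 := by
  rw [memℓp_gen_iff (by simp)] at h ⊢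
  simpa using h

theorem mem_schrodinger_domain {U : Site d → ℝ} {ψ : Hilb d} :
    ψ ∈ (schrodinger U).domain ↔ Memℓp (formalOp U (ψ : Site d → ℂ)) 2 := Iff.rfl

theorem schrodinger_apply {U : Site d → ℝ} (ψ : (schrodinger U).domain) (x : Site d) :
    schrodinger U ψ x = formalOp U ((ψ : Hilb d) : Site d → ℂ) x := rfl

/-- The quadratic form of a Schrödinger operator is real. -/
theorem im_inner_schrodinger (U : Site d → ℝ) (ψ : (schrodinger U).domain) :
    (inner ℂ (ψ : Hilb d) (schrodinger U ψ)).im = 0 := by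
  have h1 := hasSum_formalOp_symm U (memℓp_conj (lp.memℓp (ψ : Hilb d))) (lp.memℓp (ψ : Hilb d))
  have h2 := lp.hasSum_inner (𝕜 := ℂ) (ψ : Hilb d) (schrodinger U ψ)
  have h3 := (Complex.hasSum_im h2).mul_left 2
  have h4 := Complex.hasSum_im h1
  have h5 := h4.unique (h3.congr_fun fun x => ?_)
  · simp at h5
    exact h5
  · rw [formalOp_conj]
    simp only [RCLike.inner_apply, schrodinger_apply, Complex.sub_im, Complex.mul_im,
      Complex.conj_re, Complex.conj_im]
    ring

theorem im_inner_schrodinger_sub (U : Site d → ℝ) (z : ℂ) (ψ : (schrodinger U).domain) :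
    (inner ℂ (ψ : Hilb d) (schrodinger U ψ - z • (ψ : Hilb d))).im
      = - (z.im * ‖(ψ : Hilb d)‖ ^ 2) := by
  have e : inner ℂ (ψ : Hilb d) (ψ : Hilb d) = ((‖(ψ : Hilb d)‖ ^ 2 : ℝ) : ℂ) := by
    rw [inner_self_eq_norm_sq_to_K]
    push_cast
    rfl
  rw [inner_sub_right, inner_smul_right, Complex.sub_im, im_inner_schrodinger, e,
    Complex.mul_im, Complex.ofReal_re, Complex.ofReal_im]
  ring

/-- Cauchy–Schwarz applied to the imaginary part of the quadratic form. This bound supplies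
injectivity, closedness of the range and the resolvent norm. -/
theorem abs_im_mul_norm_le (U : Site d → ℝ) (z : ℂ) (ψ : (schrodinger U).domain) :
    |z.im| * ‖(ψ : Hilb d)‖ ≤ ‖schrodinger U ψ - z • (ψ : Hilb d)‖ := by
  rcases eq_or_ne ‖(ψ : Hilb d)‖ 0 with h0 | h0
  · rw [h0, mul_zero]; positivity
  have h := im_inner_schrodinger_sub U z ψ
  have h1 := (Complex.abs_im_le_norm _).trans
    (norm_inner_le_norm (𝕜 := ℂ) (ψ : Hilb d) (schrodinger U ψ - z • (ψ : Hilb d)))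
  rw [h, abs_neg, abs_mul, abs_of_nonneg (sq_nonneg ‖(ψ : Hilb d)‖)] at h1
  have hp : 0 < ‖(ψ : Hilb d)‖ := lt_of_le_of_ne (norm_nonneg _) h0.symm
  refine le_of_mul_le_mul_left ?_ hp
  linarith [h1]

/-- The standard basis vectors of `ℓ²(ℤ^d)`. -/
noncomputable abbrev delta (v : Site d) : Hilb d := lp.single 2 v (1 : ℂ)

theorem delta_apply (v x : Site d) : delta v x = if x = v then 1 else 0 := by
  rw [delta, lp.single_apply, Pi.single_apply]

theorem formalOp_delta (U : Site d → ℝ) (v : Site d) :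
    formalOp U (delta v : Site d → ℂ) =
      (((2 * d + U v : ℂ) • delta v -
        ∑ i : Fin d, (delta (v + Pi.single i 1) + delta (v - Pi.single i 1)) : Hilb d) :
          Site d → ℂ) := by
  funext x
  rw [formalOp_apply, lp.coeFn_sub, Pi.sub_apply, lp.coeFn_smul, lp.coeFn_sum, Finset.sum_apply,
    Pi.smul_apply]
  simp only [lp.coeFn_add, Pi.add_apply, delta_apply, smul_eq_mul, sub_eq_iff_eq_add,
    ← eq_sub_iff_add_eq]
  by_cases h : x = v
  · subst h
    have h1 : ∀ i : Fin d, x ≠ x - Pi.single i 1 := fun i hi => by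
      have := congrFun hi i
      simp only [Pi.sub_apply, Pi.single_eq_same] at this
      omega
    simp [h1]
    ring
  · simp [h, Finset.sum_add_distrib]

theorem delta_mem_domain (U : Site d → ℝ) (v : Site d) : delta v ∈ (schrodinger U).domain := by
  rw [mem_schrodinger_domain, formalOp_delta]
  exact lp.memℓp _

theorem schrodinger_delta (U : Site d → ℝ) (v : Site d) :
    schrodinger U ⟨delta v, delta_mem_domain U v⟩ = (2 * d + U v : ℂ) • delta v -
        ∑ i : Fin d, (delta (v + Pi.single i 1) + delta (v - Pi.single i 1)) := by
  ext x
  rw [schrodinger_apply, formalOp_delta]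

theorem inner_delta_left (v : Site d) (f : Hilb d) : inner ℂ (delta v) f = f v := by
  rw [delta, lp.inner_single_left]
  simp

/-- A vector orthogonal to all `(H - z) δ_v` vanishes. -/
theorem eq_zero_of_forall_inner_eq_zero (U : Site d → ℝ) {z : ℂ} (hz : z.im ≠ 0) (χ : Hilb d)
    (h : ∀ v, inner ℂ (schrodinger U ⟨delta v, delta_mem_domain U v⟩ - z • delta v) χ = 0) :
    χ = 0 := by
  -- Orthogonality to `(H - z) δ_v` is the equation `H χ = conj z • χ` at `v`. It places `χ` in the
  -- maximal domain, where the lower bound forces `χ = 0`.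
  have key : formalOp U (χ : Site d → ℂ) = ((starRingEnd ℂ z • χ : Hilb d) : Site d → ℂ) := by
    funext v
    have hv := h v
    rw [schrodinger_delta, inner_sub_left, inner_sub_left, inner_smul_left, inner_smul_left,
      sum_inner] at hv
    simp only [inner_add_left, inner_delta_left] at hv
    rw [formalOp_apply, lp.coeFn_smul, Pi.smul_apply, smul_eq_mul]
    simp only [map_add, map_mul, Complex.conj_ofReal, map_ofNat, map_natCast] at hv
    rw [← sub_eq_zero, ← hv]
    simp only [Finset.sum_add_distrib, Finset.sum_sub_distrib, Finset.sum_const, Finset.card_univ,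
      Fintype.card_fin, nsmul_eq_mul]
    ring
  have hd : χ ∈ (schrodinger U).domain := by
    rw [mem_schrodinger_domain, key]; exact lp.memℓp _
  have e : schrodinger U ⟨χ, hd⟩ = starRingEnd ℂ z • χ := by
    ext v
    rw [schrodinger_apply, key]
  have := abs_im_mul_norm_le U (starRingEnd ℂ z) ⟨χ, hd⟩
  rw [e, sub_self, norm_zero, Complex.conj_im, abs_neg] at this
  have h0 : ‖χ‖ ≤ 0 := by
    by_contra hc
    push Not at hc
    have := mul_pos (abs_pos.2 hz) hc
    linarith
  exact norm_le_zero_iff.1 h0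

/-- Used twice: for surjectivity of `H - z`, and as the dense set on which strong resolvent
continuity is checked. -/
theorem closure_span_eq_top (U : Site d → ℝ) {z : ℂ} (hz : z.im ≠ 0) :
    (Submodule.span ℂ (Set.range fun v : Site d =>
      (schrodinger U ⟨delta v, delta_mem_domain U v⟩ - z • delta v))).topologicalClosure = ⊤ := by
  rw [Submodule.topologicalClosure_eq_top_iff, Submodule.eq_bot_iff]
  intro χ hχ
  refine eq_zero_of_forall_inner_eq_zero U hz χ fun v => ?_
  exact (Submodule.mem_orthogonal _ _).1 hχ _ (Submodule.subset_span ⟨v, rfl⟩)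

/-- The map `H - z` on the domain of `H`. -/
noncomputable def shifted (U : Site d → ℝ) (z : ℂ) : (schrodinger U).domain →ₗ[ℂ] Hilb d :=
  (schrodinger U).toFun - z • (schrodinger U).domain.subtype

theorem shifted_apply (U : Site d → ℝ) (z : ℂ) (ψ : (schrodinger U).domain) :
    shifted U z ψ = schrodinger U ψ - z • (ψ : Hilb d) := rfl

theorem continuous_formalOp (U : Site d → ℝ) (x : Site d) :
    Continuous fun ψ : Hilb d => formalOp U (ψ : Site d → ℂ) x := by
  have h : ∀ y : Site d, Continuous fun ψ : Hilb d => (ψ : Site d → ℂ) y := fun y =>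
    (lp.evalCLM ℂ (fun _ : Site d => ℂ) 2 y).continuous
  simp only [formalOp_apply]
  exact (continuous_finsetSum _ fun i _ => ((h x).sub (h _)).add ((h x).sub (h _))).add
    (continuous_const.mul (h x))

/-- The lower bound makes preimages of a convergent sequence Cauchy. Each coordinate of the formal
operator is continuous on `ℓ²`, so the equation passes to the limit. -/
theorem isClosed_range_shifted (U : Site d → ℝ) {z : ℂ} (hz : z.im ≠ 0) :
    IsClosed ((LinearMap.range (shifted U z) : Submodule ℂ (Hilb d)) : Set (Hilb d)) := by
  have hz' := abs_pos.2 hz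
  refine IsSeqClosed.isClosed fun f χ hf hχ => ?_
  choose ψ hψ using hf
  have hc : CauchySeq fun n => (ψ n : Hilb d) := by
    have := hχ.cauchySeq
    rw [Metric.cauchySeq_iff'] at this ⊢
    intro η hη
    obtain ⟨N, hN⟩ := this (|z.im| * η) (by positivity)
    refine ⟨N, fun n hn => ?_⟩
    have h1 := hN n hn
    have h2 := abs_im_mul_norm_le U z (ψ n - ψ N)
    rw [← shifted_apply, map_sub, hψ, hψ, ← dist_eq_norm, Submodule.coe_sub,
      ← dist_eq_norm] at h2
    exact lt_of_mul_lt_mul_left (h2.trans_lt h1) hz'.le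
  obtain ⟨ψ₀, hψ₀⟩ := cauchySeq_tendsto_of_complete hc
  have key : formalOp U (ψ₀ : Site d → ℂ) = ((χ + z • ψ₀ : Hilb d) : Site d → ℂ) := by
    funext x
    have h1 := ((continuous_formalOp U x).tendsto ψ₀).comp hψ₀
    have h2 := ((lp.evalCLM ℂ (fun _ : Site d => ℂ) 2 x).continuous.tendsto _).comp
      (hχ.add (hψ₀.const_smul z))
    refine tendsto_nhds_unique h1 (h2.congr fun n => ?_)
    have : f n + z • (ψ n : Hilb d) = schrodinger U (ψ n) := by
      rw [← hψ, shifted_apply, sub_add_cancel]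
    simp only [Function.comp, this]
    rfl
  have hd : ψ₀ ∈ (schrodinger U).domain := by
    rw [mem_schrodinger_domain, key]; exact lp.memℓp _
  refine ⟨⟨ψ₀, hd⟩, ?_⟩
  rw [shifted_apply, sub_eq_iff_eq_add]
  ext x
  rw [schrodinger_apply, key]

theorem range_shifted (U : Site d → ℝ) {z : ℂ} (hz : z.im ≠ 0) :
    LinearMap.range (shifted U z) = ⊤ := by
  rw [eq_top_iff, ← closure_span_eq_top U hz]
  refine Submodule.topologicalClosure_minimal _ ?_ (isClosed_range_shifted U hz)
  rw [Submodule.span_le]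
  rintro _ ⟨v, rfl⟩
  exact ⟨⟨delta v, delta_mem_domain U v⟩, rfl⟩

theorem shifted_injective (U : Site d → ℝ) {z : ℂ} (hz : z.im ≠ 0) :
    Function.Injective (shifted U z) := by
  rw [← LinearMap.ker_eq_bot, LinearMap.ker_eq_bot']
  intro ψ hψ
  have h := abs_im_mul_norm_le U z ψ
  rw [← shifted_apply, hψ, norm_zero] at h
  have h0 : ‖(ψ : Hilb d)‖ ≤ 0 := by
    by_contra hc
    push Not at hc
    have := mul_pos (abs_pos.2 hz) hc
    linarith
  exact Subtype.ext (norm_le_zero_iff.1 h0)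

theorem exists_isResolventAt (U : Site d → ℝ) {z : ℂ} (hz : z.im ≠ 0) :
    ∃ R, IsResolventAt (schrodinger U) z R := by
  have hz' := abs_pos.2 hz
  let e : (schrodinger U).domain ≃ₗ[ℂ] Hilb d := LinearEquiv.ofBijective (shifted U z)
    ⟨shifted_injective U hz, LinearMap.range_eq_top.1 (range_shifted U hz)⟩
  have he : ∀ φ, schrodinger U (e.symm φ) - z • ((e.symm φ : (schrodinger U).domain) : Hilb d) = φ :=
    fun φ => e.apply_symm_apply φ
  refine ⟨((schrodinger U).domain.subtype ∘ₗ e.symm.toLinearMap).mkContinuous |z.im|⁻¹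
    fun φ => ?_, fun φ => ⟨(e.symm φ).2, he φ⟩, fun ψ => ?_⟩
  · have := abs_im_mul_norm_le U z (e.symm φ)
    rw [he] at this
    rw [inv_mul_eq_div, le_div_iff₀ hz', mul_comm]
    exact this
  · change ((e.symm (e ψ) : (schrodinger U).domain) : Hilb d) = ψ
    rw [e.symm_apply_apply]

theorem isResolventAt_resolventOp (U : Site d → ℝ) {z : ℂ} (hz : z.im ≠ 0) :
    IsResolventAt (schrodinger U) z (resolventOp (schrodinger U) z) := by
  have h := exists_isResolventAt U hz
  rw [resolventOp, dif_pos h]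
  exact h.choose_spec

theorem norm_resolventOp_apply_le (U : Site d → ℝ) {z : ℂ} (hz : z.im ≠ 0) (φ : Hilb d) :
    |z.im| * ‖resolventOp (schrodinger U) z φ‖ ≤ ‖φ‖ := by
  obtain ⟨h, e⟩ := (isResolventAt_resolventOp U hz).1 φ
  have := abs_im_mul_norm_le U z ⟨_, h⟩
  rwa [e] at this

/-! ### The Green function: Ward identity, row equation, dependence on the potential -/

theorem green_eq (U : Site d → ℝ) (z : ℂ) (x y : Site d) :
    green U z x y = resolventOp (schrodinger U) z (delta y) x := inner_delta_left _ _

/-- The Ward identity, as a bound. -/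
theorem im_mul_norm_green_sq_le (U : Site d → ℝ) {z : ℂ} (hz : 0 < z.im) (x v : Site d) :
    z.im * ‖green U z x v‖ ^ 2 ≤ ‖green U z v v‖ := by
  obtain ⟨h, e⟩ := (isResolventAt_resolventOp U hz.ne').1 (delta v)
  -- For `ψ = R δ_v` the quadratic form gives `Im G(v, v) = Im z * ‖ψ‖²`, and `G(x, v)` is one
  -- coordinate of `ψ`.
  have h1 := im_inner_schrodinger_sub U z ⟨_, h⟩
  rw [e, ← inner_conj_symm, inner_delta_left, ← green_eq, Complex.conj_im] at h1
  have h2 := lp.norm_apply_le_norm (two_ne_zero) (resolventOp (schrodinger U) z (delta v)) x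
  rw [← green_eq] at h2
  have h3 := Complex.im_le_norm (green U z v v)
  have h4 : ‖green U z x v‖ ^ 2 ≤ ‖resolventOp (schrodinger U) z (delta v)‖ ^ 2 := by gcongr
  simp only at h1
  nlinarith

theorem im_mul_norm_green_le (U : Site d → ℝ) {z : ℂ} (hz : 0 < z.im) (x v : Site d) :
    z.im * ‖green U z x v‖ ≤ 1 := by
  have h := norm_resolventOp_apply_le U hz.ne' (delta v)
  have h2 := lp.norm_apply_le_norm (two_ne_zero) (resolventOp (schrodinger U) z (delta v)) x
  rw [← green_eq] at h2
  rw [delta, lp.norm_single (by simp), norm_one, abs_of_pos hz] at h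
  exact (mul_le_mul_of_nonneg_left h2 hz.le).trans h

/-- The equation satisfied by a row of the Green function. -/
theorem formalOp_green (U : Site d → ℝ) {z : ℂ} (hz : z.im ≠ 0) (x v : Site d) :
    formalOp U (fun y => green U z x y) v - z * green U z x v = if x = v then 1 else 0 := by
  have h := (isResolventAt_resolventOp U hz).2 ⟨delta v, delta_mem_domain U v⟩
  have h' := congrArg (fun f : Hilb d => (f : Site d → ℂ) x) h
  simp only [schrodinger_delta, map_sub, map_smul, map_sum, map_add, delta_apply] at h'
  rw [← h', formalOp_apply]
  simp only [lp.coeFn_sub, lp.coeFn_smul, lp.coeFn_sum, lp.coeFn_add, Pi.sub_apply, Pi.smul_apply,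
    Finset.sum_apply, Pi.add_apply, ← green_eq, smul_eq_mul]
  simp only [Finset.sum_add_distrib, Finset.sum_sub_distrib, Finset.sum_const, Finset.card_univ,
      Fintype.card_fin, nsmul_eq_mul]
  ring

theorem schrodinger_update_delta (U U' : Site d → ℝ) (v : Site d) :
    schrodinger U ⟨delta v, delta_mem_domain U v⟩ - schrodinger U' ⟨delta v, delta_mem_domain U' v⟩
      = ((U v - U' v : ℝ) : ℂ) • delta v := by
  rw [schrodinger_delta, schrodinger_delta, sub_sub_sub_cancel_right, ← sub_smul]
  congr 1
  push_cast
  ring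

/-- Strong resolvent continuity with respect to pointwise convergence of the potential. -/
theorem continuous_resolventOp {z : ℂ} (hz : z.im ≠ 0) (f : Hilb d) :
    Continuous fun U : Site d → ℝ => resolventOp (schrodinger U) z f := by
  have hz' := abs_pos.2 hz
  rw [continuous_iff_continuousAt]
  intro U₀
  have hf : f ∈ (Submodule.span ℂ (Set.range fun v : Site d =>
      (schrodinger U₀ ⟨delta v, delta_mem_domain U₀ v⟩ - z • delta v))).topologicalClosure := by
    rw [closure_span_eq_top U₀ hz]; trivial
  have hspan : ∀ h ∈ Submodule.span ℂ (Set.range fun v : Site d =>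
      (schrodinger U₀ ⟨delta v, delta_mem_domain U₀ v⟩ - z • delta v)),
      ContinuousAt (fun U : Site d → ℝ => resolventOp (schrodinger U) z h) U₀ := by
    intro h hh
    induction hh using Submodule.span_induction with
    | zero => simp only [map_zero]; exact continuousAt_const
    | add a b _ _ ha hb => simp only [map_add]; exact ha.add hb
    | smul c a _ ha => simp only [map_smul]; exact ha.const_smul c
    | mem h hh =>
      obtain ⟨v, rfl⟩ := hh
      -- Changing the potential alters `H δ_v` only by a multiple of `δ_v`, so on these vectors the
      -- resolvent depends on `U` through `U v` and a bounded term.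
      have e : ∀ U : Site d → ℝ, resolventOp (schrodinger U) z
          (schrodinger U₀ ⟨delta v, delta_mem_domain U₀ v⟩ - z • delta v) =
            delta v + ((U₀ v - U v : ℝ) : ℂ) • resolventOp (schrodinger U) z (delta v) := by
        intro U
        have h1 : resolventOp (schrodinger U) z
            (schrodinger U ⟨delta v, delta_mem_domain U v⟩ - z • delta v) = delta v :=
          (isResolventAt_resolventOp U hz).2 ⟨delta v, delta_mem_domain U v⟩
        rw [← map_smul, ← schrodinger_update_delta U₀ U v, ← sub_eq_iff_eq_add]
        rw [← map_sub]
        refine (congrArg _ ?_).trans h1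
        abel
      simp only [e]
      refine continuousAt_const.add ?_
      rw [ContinuousAt, sub_self, Complex.ofReal_zero, zero_smul,
        tendsto_zero_iff_norm_tendsto_zero]
      have hlim : Tendsto (fun U : Site d → ℝ => |U₀ v - U v| * |z.im|⁻¹) (𝓝 U₀) (𝓝 0) := by
        have : Continuous fun U : Site d → ℝ => |U₀ v - U v| * |z.im|⁻¹ := by fun_prop
        simpa using this.tendsto U₀
      refine squeeze_zero (fun _ => norm_nonneg _) (fun U => ?_) hlim
      rw [norm_smul, Complex.norm_real, Real.norm_eq_abs]
      gcongr
      have := norm_resolventOp_apply_le U hz (delta v)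
      rw [delta, lp.norm_single (by simp), norm_one] at this
      rwa [← one_div, le_div_iff₀ hz', mul_comm]
  rw [Metric.continuousAt_iff']
  intro η hη
  obtain ⟨h, hh, hd⟩ := Metric.mem_closure_iff.1 hf (|z.im| * (η / 3)) (by positivity)
  have hb : ∀ U : Site d → ℝ, dist (resolventOp (schrodinger U) z f)
      (resolventOp (schrodinger U) z h) < η / 3 := by
    intro U
    rw [dist_eq_norm] at hd ⊢
    rw [← map_sub]
    exact lt_of_mul_lt_mul_left ((norm_resolventOp_apply_le U hz _).trans_lt hd) hz'.le
  filter_upwards [Metric.continuousAt_iff'.1 (hspan h hh) (η / 3) (by positivity)] with U hU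
  have h1 := hb U
  have h2 := hb U₀
  rw [dist_comm] at h2
  have := dist_triangle4 (resolventOp (schrodinger U) z f) (resolventOp (schrodinger U) z h)
    (resolventOp (schrodinger U₀) z h) (resolventOp (schrodinger U₀) z f)
  linarith

/-- Continuity for the product topology is what makes the Green function a measurable function of
the random potential. -/
theorem continuous_green {z : ℂ} (hz : z.im ≠ 0) (x y : Site d) :
    Continuous fun U : Site d → ℝ => green U z x y := by
  simp only [green_eq]
  exact (lp.evalCLM ℂ (fun _ : Site d => ℂ) 2 x).continuous.comp (continuous_resolventOp hz _)

/-- The resolvent identity for potentials that differ at one site. -/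
theorem green_update_sub (U : Site d → ℝ) {z : ℂ} (hz : z.im ≠ 0) (v : Site d) (s t : ℝ) :
    green (Function.update U v s) z v v - green (Function.update U v t) z v v
      = ((t - s : ℝ) : ℂ) * (green (Function.update U v s) z v v *
        green (Function.update U v t) z v v) := by
  set Us := Function.update U v s
  set Ut := Function.update U v t
  obtain ⟨h, e⟩ := (isResolventAt_resolventOp Us hz).1 (delta v)
  set ψ := resolventOp (schrodinger Us) z (delta v)
  have key : formalOp Ut (ψ : Site d → ℂ) =
      ((schrodinger Us ⟨ψ, h⟩ + (((t - s : ℝ) : ℂ) * ψ v) • delta v : Hilb d) : Site d → ℂ) := by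
    funext x
    rw [lp.coeFn_add, Pi.add_apply, schrodinger_apply, lp.coeFn_smul, Pi.smul_apply, delta_apply,
      formalOp_apply, formalOp_apply, smul_eq_mul]
    by_cases hx : x = v
    · subst hx
      simp only [Us, Ut, Function.update_self, if_true]
      push_cast
      ring
    · simp [Us, Ut, hx]
  have hd : ψ ∈ (schrodinger Ut).domain := by
    rw [mem_schrodinger_domain, key]; exact lp.memℓp _
  have e2 : schrodinger Ut ⟨ψ, hd⟩ - z • ψ = (1 + ((t - s : ℝ) : ℂ) * ψ v) • delta v := by
    have : schrodinger Ut ⟨ψ, hd⟩ = schrodinger Us ⟨ψ, h⟩ + (((t - s : ℝ) : ℂ) * ψ v) • delta v := by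
      ext x
      rw [schrodinger_apply, key]
    rw [this, add_sub_right_comm, e, add_smul, one_smul]
  have h3 := (isResolventAt_resolventOp Ut hz).2 ⟨ψ, hd⟩
  simp only at h3
  rw [e2, map_smul] at h3
  have h4 := congrArg (fun f : Hilb d => (f : Site d → ℂ) v) h3
  simp only [lp.coeFn_smul, Pi.smul_apply, smul_eq_mul, ← green_eq] at h4
  have h5 : ψ v = green Us z v v := (green_eq _ _ _ _).symm
  rw [h5] at h4
  linear_combination -h4

/-- The values of the potential at a site for which the diagonal Green function there is large form a set of small diameter. -/
theorem abs_sub_le_of_le_norm_green (U : Site d → ℝ) {z : ℂ} (hz : z.im ≠ 0) (v : Site d)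
    {s t L : ℝ} (hL : 0 < L) (hs : L ≤ ‖green (Function.update U v s) z v v‖)
    (ht : L ≤ ‖green (Function.update U v t) z v v‖) : |s - t| ≤ 2 / L := by
  have h := congrArg norm (green_update_sub U hz v s t)
  rw [norm_mul, norm_mul, Complex.norm_real, Real.norm_eq_abs, abs_sub_comm] at h
  have h1 := norm_sub_le (green (Function.update U v s) z v v) (green (Function.update U v t) z v v)
  rw [h] at h1
  clear h
  generalize ‖green (Function.update U v s) z v v‖ = a at *
  generalize ‖green (Function.update U v t) z v v‖ = b at *
  have ha : 0 < a := hL.trans_le hs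
  have hb : 0 < b := hL.trans_le ht
  rw [le_div_iff₀ hL]
  -- The resolvent identity says that `1/G` is affine in the potential with unit slope, so `|s - t|
  -- ≤ 1/a + 1/b ≤ 2/L`; here with denominators cleared.
  refine le_of_mul_le_mul_right ?_ (mul_pos ha hb)
  have h2 : |s - t| * (a * b) * L ≤ (a + b) * L := mul_le_mul_of_nonneg_right h1 hL.le
  have h3 : a * L ≤ a * b := mul_le_mul_of_nonneg_left ht ha.le
  have h4 : b * L ≤ b * a := mul_le_mul_of_nonneg_left hs hb.le
  linarith

/-! ### Restriction to a box and its spectral projection -/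

theorem restrictOp_apply (U : Site d → ℝ) (B : Finset (Site d)) (φ : EuclideanSpace ℂ B) (v : B) :
    restrictOp U B φ v =
      formalOp U (Function.extend (Subtype.val : B → Site d) (φ : B → ℂ) 0) v := rfl

theorem extend_coe {B : Finset (Site d)} (φ : B → ℂ) (v : B) :
    Function.extend (Subtype.val : B → Site d) φ 0 v = φ v :=
  Subtype.val_injective.extend_apply _ _ _

theorem extend_of_notMem {B : Finset (Site d)} (φ : B → ℂ) {x : Site d} (hx : x ∉ B) :
    Function.extend (Subtype.val : B → Site d) φ 0 x = 0 := by
  rw [Function.extend_apply']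
  · rfl
  · rintro ⟨v, rfl⟩
    exact hx v.2

theorem memℓp_extend {B : Finset (Site d)} (φ : B → ℂ) :
    Memℓp (Function.extend (Subtype.val : B → Site d) φ 0) 2 := by
  refine memℓp_gen (summable_of_ne_finset_zero (s := B) fun x hx => ?_)
  rw [extend_of_notMem _ hx]
  simp

theorem isSymmetric_restrictOp (U : Site d → ℝ) (B : Finset (Site d)) :
    (restrictOp U B).IsSymmetric := by
  intro φ ψ
  set φ' := Function.extend (Subtype.val : B → Site d) (φ : B → ℂ) 0 with hφ'
  set ψ' := Function.extend (Subtype.val : B → Site d) (ψ : B → ℂ) 0 with hψ'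
  have h1 := hasSum_formalOp_symm U (memℓp_conj (memℓp_extend (φ : B → ℂ)))
    (memℓp_extend (ψ : B → ℂ))
  have h2 := h1.unique (hasSum_sum_of_ne_finset_zero (s := B) fun x hx => by
    rw [extend_of_notMem _ hx, extend_of_notMem _ hx]; simp)
  rw [← Finset.sum_coe_sort, Finset.sum_sub_distrib] at h2
  rw [PiLp.inner_apply, PiLp.inner_apply, eq_comm, ← sub_eq_zero, h2]
  congr 1
  · refine Finset.sum_congr rfl fun v _ => ?_
    rw [restrictOp_apply, extend_coe, RCLike.inner_apply]
    ring
  · refine Finset.sum_congr rfl fun v _ => ?_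
    rw [restrictOp_apply, extend_coe, RCLike.inner_apply, formalOp_conj]
    ring

section Gap

variable {E : Type*} [NormedAddCommGroup E] [InnerProductSpace ℂ E] [FiniteDimensional ℂ E]

/-- Away from the eigenspace at `lam`, a symmetric operator minus `lam` is bounded below by the
distance of `lam` to the rest of the spectrum. -/
theorem gap_mul_norm_le {T : Module.End ℂ E} (hT : T.IsSymmetric) {lam δ : ℝ} (hδ : 0 ≤ δ)
    (hgap : ∀ l ∈ spectrum ℂ T, l ≠ (lam : ℂ) → δ ≤ ‖l - lam‖) {f : E}
    (hf : f ∈ (Module.End.eigenspace T (lam : ℂ))ᗮ) : δ * ‖f‖ ≤ ‖T f - (lam : ℂ) • f‖ := by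
  -- In an eigenbasis the inequality holds coordinate by coordinate: coordinates with eigenvalue
  -- `lam` vanish, the others are multiplied by at least `δ`.
  set b := hT.eigenvectorBasis rfl
  have hn : ∀ g : E, ‖g‖ ^ 2 = ∑ i, ‖(b.repr g).ofLp i‖ ^ 2 := fun g => by
    rw [← b.repr.norm_map g, EuclideanSpace.norm_sq_eq]
  refine le_of_sq_le_sq ?_ (norm_nonneg _)
  rw [mul_pow, hn, hn, Finset.mul_sum]
  refine Finset.sum_le_sum fun i _ => ?_
  have h1 : (b.repr (T f - (lam : ℂ) • f)).ofLp i
      = ((hT.eigenvalues rfl i : ℂ) - lam) * (b.repr f).ofLp i := by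
    rw [map_sub, map_smul, PiLp.sub_apply, PiLp.smul_apply,
      hT.eigenvectorBasis_apply_self_apply rfl, smul_eq_mul, sub_mul]
    rfl
  rw [h1, norm_mul, mul_pow]
  by_cases h : (hT.eigenvalues rfl i : ℂ) = lam
  · have hb : b i ∈ Module.End.eigenspace T (lam : ℂ) := by
      rw [Module.End.mem_eigenspace_iff, ← h]
      exact hT.apply_eigenvectorBasis rfl i
    have h0 : (b.repr f).ofLp i = 0 := by
      rw [b.repr_apply_apply]
      exact (Submodule.mem_orthogonal _ _).1 hf _ hb
    rw [h0]
    simp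
  · have := hgap _ (hT.hasEigenvalue_eigenvalues rfl i).mem_spectrum h
    gcongr
    exact this

end Gap

theorem norm_le_sum_norm {ι : Type*} [Fintype ι] (f : EuclideanSpace ℂ ι) :
    ‖f‖ ≤ ∑ i, ‖f i‖ := by
  rw [EuclideanSpace.norm_eq]
  refine Real.sqrt_le_iff.2 ⟨Finset.sum_nonneg fun _ _ => norm_nonneg _, ?_⟩
  exact Finset.sum_sq_le_sq_sum_of_nonneg fun _ _ => norm_nonneg _

/-- The contribution to `P_B (-Δ) P_B^*` at `v` of the values of `w` outside of `B`. -/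
noncomputable def boundaryTerm (B : Finset (Site d)) (w : Site d → ℂ) (v : Site d) : ℂ :=
  ∑ i : Fin d, ((if v + Pi.single i 1 ∈ B then 0 else w (v + Pi.single i 1)) +
    (if v - Pi.single i 1 ∈ B then 0 else w (v - Pi.single i 1)))

theorem restrictOp_restrict (U : Site d → ℝ) (B : Finset (Site d)) (w : Site d → ℂ) (v : B) :
    restrictOp U B (WithLp.toLp 2 fun u : B => w u) v = formalOp U w v + boundaryTerm B w v := by
  have h : ∀ x : Site d, Function.extend (Subtype.val : B → Site d) (fun u : B => w u) 0 x =
      w x - if x ∈ B then 0 else w x := by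
    intro x
    by_cases hx : x ∈ B
    · rw [extend_coe (fun u : B => w u) ⟨x, hx⟩]; simp [hx]
    · rw [extend_of_notMem _ hx]; simp [hx]
  rw [restrictOp_apply, formalOp_apply, formalOp_apply, boundaryTerm, add_right_comm,
    ← Finset.sum_add_distrib]
  simp only [h]
  congr 1
  · refine Finset.sum_congr rfl fun i _ => ?_
    simp only [v.2, if_true]
    ring
  · simp [v.2]

variable {V₀ W : Site d → ℝ} {B : Finset (Site d)} {lam ε δ : ℝ} {w : Site d → ℂ}

/-- If `w` solves `(-Δ + V₀ + W - λ - iε) w = ε δ_x` on `B`, where `W` vanishes on the support of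
the eigenfunctions at `λ`, then the entries of the spectral projection are controlled by `w`. -/
theorem norm_entry_le (hε : 0 < ε) (hδ : 0 < δ)
    (hgap : ∀ l ∈ spectrum ℂ (restrictOp V₀ B), l ≠ (lam : ℂ) → δ ≤ ‖l - (lam : ℂ)‖)
    (hsupp : ∀ φ : EuclideanSpace ℂ B, ∀ v : B, W v ≠ 0 → spectralProj V₀ B lam φ v = 0)
    (x y : B)
    (hw : ∀ v : B, formalOp (fun u => V₀ u + W u) w v - (lam + ε * Complex.I) * w v =
      if (x : Site d) = v then (ε : ℂ) else 0) :
    ‖entry (spectralProj V₀ B lam) x y‖ ≤ ‖w y‖ + ε⁻¹ * ∑ v : B, ‖boundaryTerm B w v‖ +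
      δ⁻¹ * (ε + ε * ∑ v : B, ‖w v‖ + ∑ v : B, ‖(W v : ℂ) * w v‖ +
        ∑ v : B, ‖boundaryTerm B w v‖) := by
  set A := restrictOp V₀ B with hA
  have hsym : A.IsSymmetric := isSymmetric_restrictOp V₀ B
  set K := Module.End.eigenspace A (lam : ℂ) with hK
  set P := spectralProj V₀ B lam with hP
  have hPK : P = K.starProjection := rfl
  set wB : EuclideanSpace ℂ B := WithLp.toLp 2 fun v : B => w v with hwB
  set q : EuclideanSpace ℂ B := WithLp.toLp 2 fun v : B => (W v : ℂ) * w v with hq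
  set s : EuclideanSpace ℂ B := WithLp.toLp 2 fun v : B => boundaryTerm B w v with hs
  set F := A wB - (lam : ℂ) • wB with hF
  have hFeq : F = (ε : ℂ) • EuclideanSpace.single x (1 : ℂ) + (ε * Complex.I) • wB - q + s := by
    ext v
    have h1 : A wB v = formalOp V₀ w v + boundaryTerm B w v := restrictOp_restrict V₀ B w v
    have h2 := hw v
    rw [formalOp_apply] at h1 h2
    simp only [hF, PiLp.sub_apply, PiLp.add_apply, PiLp.smul_apply, h1, smul_eq_mul,
      PiLp.single_apply]
    simp only [hwB, hq, hs]
    have h3 : (if v = x then (1 : ℂ) else 0) * ε = if (x : Site d) = v then (ε : ℂ) else 0 := by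
      by_cases h : v = x
      · simp [h]
      · have h' : ¬ (x : Site d) = v := fun e => h (Subtype.ext e.symm)
        simp [h, h']
    rw [mul_comm (ε : ℂ) (if v = x then (1 : ℂ) else 0), h3, ← h2]
    push_cast
    ring
  have hPz : ∀ f : EuclideanSpace ℂ B, f ∈ Kᗮ → P f = 0 := fun f hf => by
    rw [hPK]; exact (Submodule.starProjection_apply_eq_zero_iff _).2 hf
  -- By symmetry the range of `A - lam` is orthogonal to its kernel.
  have hFK : F ∈ Kᗮ := by
    rw [Submodule.mem_orthogonal]
    intro e he
    have he' := Module.End.mem_eigenspace_iff.1 he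
    rw [hF, inner_sub_right, ← hsym, he', inner_smul_left, inner_smul_right, Complex.conj_ofReal,
      sub_self]
  -- The disjointness of `W` and the eigenfunctions makes the random potential invisible to `P`,
  -- whatever its size.
  have hqK : q ∈ Kᗮ := by
    rw [Submodule.mem_orthogonal]
    intro e he
    have he' : P e = e := by rw [hPK]; exact Submodule.starProjection_eq_self_iff.2 he
    rw [PiLp.inner_apply]
    refine Finset.sum_eq_zero fun v _ => ?_
    by_cases hv : W v = 0
    · simp [hq, hv]
    · have := hsupp e v hv
      rw [he'] at this
      simp [this]
  have hε' : (ε : ℂ) ≠ 0 := by exact_mod_cast hε.ne'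
  have hPw : P wB = Complex.I • P (EuclideanSpace.single x (1 : ℂ)) +
      (Complex.I * (ε : ℂ)⁻¹) • P s := by
    have h := hPz F hFK
    rw [hFeq, map_add, map_sub, map_add, map_smul, map_smul, hPz q hqK, sub_zero] at h
    have h' := congrArg (fun f => (Complex.I * (ε : ℂ)⁻¹) • f) h
    simp only [smul_add, smul_smul, smul_zero] at h'
    rw [show Complex.I * (ε : ℂ)⁻¹ * ε = Complex.I by field_simp,
      show Complex.I * (ε : ℂ)⁻¹ * (ε * Complex.I) = -1 by
        field_simp; exact Complex.I_sq, neg_one_smul] at h'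
    rw [← sub_eq_zero, ← neg_eq_zero, ← h']
    abel
  have hentry : ‖(P (EuclideanSpace.single x (1 : ℂ))) y‖ = ‖entry P x y‖ := by
    rw [entry, hPK, ← Submodule.inner_starProjection_left_eq_right, ← inner_conj_symm,
      RCLike.norm_conj, EuclideanSpace.inner_single_left]
    simp
  have hPs : ‖P s y‖ ≤ ∑ v : B, ‖boundaryTerm B w v‖ :=
    (PiLp.norm_apply_le _ y).trans ((K.norm_starProjection_apply_le s).trans (norm_le_sum_norm s))
  have h1 : ‖entry P x y‖ ≤ ‖P wB y‖ + ε⁻¹ * ∑ v : B, ‖boundaryTerm B w v‖ := by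
    have e : Complex.I * (P (EuclideanSpace.single x (1 : ℂ))) y =
        P wB y - (Complex.I * (ε : ℂ)⁻¹) * P s y := by
      rw [hPw]; simp
    have := congrArg norm e
    rw [norm_mul, Complex.norm_I, one_mul, hentry] at this
    rw [this]
    refine (norm_sub_le _ _).trans ?_
    rw [norm_mul, norm_mul, Complex.norm_I, one_mul, norm_inv, Complex.norm_real,
      Real.norm_of_nonneg hε.le]
    gcongr
  -- Subtracting `P wB` does not change `F`, since `A - lam` annihilates it.
  have h2 : δ * ‖wB - P wB‖ ≤ ‖F‖ := by
    have hmem : wB - P wB ∈ Kᗮ := K.sub_starProjection_mem_orthogonal wB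
    have hp : A (P wB) = (lam : ℂ) • P wB :=
      Module.End.mem_eigenspace_iff.1 (K.starProjection_apply_mem wB)
    have := gap_mul_norm_le hsym hδ.le hgap hmem
    rwa [map_sub, hp, smul_sub, sub_sub_sub_cancel_right] at this
  have h3 : ‖F‖ ≤ ε + ε * ∑ v : B, ‖w v‖ + ∑ v : B, ‖(W v : ℂ) * w v‖ +
        ∑ v : B, ‖boundaryTerm B w v‖ := by
    rw [hFeq]
    refine (norm_add_le _ _).trans (add_le_add ((norm_sub_le _ _).trans (add_le_add
      ((norm_add_le _ _).trans (add_le_add ?_ ?_)) (norm_le_sum_norm q))) (norm_le_sum_norm s))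
    · rw [norm_smul, Complex.norm_real, Real.norm_of_nonneg hε.le]
      simp
    · rw [norm_smul, norm_mul, Complex.norm_I, mul_one, Complex.norm_real,
        Real.norm_of_nonneg hε.le]
      exact mul_le_mul_of_nonneg_left (norm_le_sum_norm wB) hε.le
  have h4 : ‖P wB y‖ ≤ ‖w y‖ + δ⁻¹ * ‖F‖ := by
    have e : P wB y = w y - (wB - P wB) y := by simp [hwB]
    rw [e]
    refine (norm_sub_le _ _).trans (add_le_add le_rfl ((PiLp.norm_apply_le _ y).trans ?_))
    rw [inv_mul_eq_div, le_div_iff₀ hδ, mul_comm]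
    exact h2
  have h5 := mul_le_mul_of_nonneg_left h3 (inv_pos.2 hδ).le
  linarith

/-! ### Probability estimates and the passage to the expected moment -/

section Probability

variable {Ω : Type*} [MeasurableSpace Ω] {Pr : Measure Ω}
  {Γ : Set (Site d)} {μ : Measure ℝ} {V : Site d → Ω → ℝ}

theorem IsTrimmedPotential.measurable_all (hV : IsTrimmedPotential Pr Γ μ V) (v : Site d) :
    Measurable (V v) := by
  by_cases h : v ∈ Γ
  · exact hV.measurable v h
  · rw [funext (hV.off v h)]
    exact measurable_const

theorem IsTrimmedPotential.measurable_green (hV : IsTrimmedPotential Pr Γ μ V)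
    (V₀ : Site d → ℝ) (g : ℝ) {z : ℂ} (hz : z.im ≠ 0) (x y : Site d) :
    Measurable fun ω => green (fun v => V₀ v + g * V v ω) z x y := by
  refine (continuous_green hz x y).measurable.comp (measurable_pi_lambda _ fun v => ?_)
  exact ((hV.measurable_all v).const_mul g).const_add _

/-- The potential at one site is independent of the potential at all other sites. -/
theorem IsTrimmedPotential.indepFun_update (hV : IsTrimmedPotential Pr Γ μ V)
    {v : Site d} (hv : v ∈ Γ) :
    IndepFun (V v) (fun ω => Function.update (fun u => V u ω) v 0) Pr := by
  have hle : ∀ u : Γ, (MeasurableSpace.comap (V u) inferInstance) ≤ ‹MeasurableSpace Ω› :=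
    fun u => (hV.measurable u u.2).comap_le
  have h := indep_iSup_of_disjoint hle ((iIndepFun_iff_iIndep _ _ _).1 hV.indep)
    (S := {(⟨v, hv⟩ : Γ)}) (T := {(⟨v, hv⟩ : Γ)}ᶜ) disjoint_compl_right
  rw [IndepFun_iff_Indep]
  refine indep_of_indep_of_le_left (indep_of_indep_of_le_right h ?_) ?_
  -- The `v` coordinate and all coordinates off `Γ` are constant, so the frozen configuration is
  -- measurable with respect to the other sites of `Γ`.
  · refine measurable_iff_comap_le.1 ((@measurable_pi_iff _ _ _ (_) _ _).2 fun u => ?_)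
    by_cases huv : u = v
    · subst huv
      simp only [Function.update_self]
      exact @measurable_const _ _ _ _ _
    · simp only [Function.update_of_ne huv]
      by_cases hu : u ∈ Γ
      · have h1 : MeasurableSpace.comap (V u) inferInstance ≤
            ⨆ i ∈ ({(⟨v, hv⟩ : Γ)}ᶜ : Set Γ), MeasurableSpace.comap (V i) inferInstance :=
          le_iSup₂_of_le (⟨u, hu⟩ : Γ) (by simpa using huv) le_rfl
        exact measurable_iff_comap_le.2 h1
      · simp only [hV.off u hu]
        exact @measurable_const _ _ _ _ _
  · exact le_iSup₂_of_le (⟨v, hv⟩ : Γ) rfl le_rfl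

/-- A Wegner-type estimate: the diagonal Green function at a site of `Γ` is rarely large. -/
theorem IsTrimmedPotential.measure_le_norm_green_le [IsProbabilityMeasure Pr]
    (hV : IsTrimmedPotential Pr Γ μ V) {V₀ : Site d → ℝ} {g : ℝ} (hg : 0 < g)
    {z : ℂ} (hz : z.im ≠ 0) {v : Site d} (hv : v ∈ Γ) {K α : ℝ}
    (hreg : ∀ ε > (0 : ℝ), ∀ t : ℝ, μ (Set.Icc (t - ε) (t + ε)) ≤ ENNReal.ofReal (K * ε ^ α))
    {L : ℝ} (hL : 0 < L) :
    Pr {ω | L ≤ ‖green (fun u => V₀ u + g * V u ω) z v v‖} ≤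
      ENNReal.ofReal (K * (2 / (g * L)) ^ α) := by
  set Y : Ω → Site d → ℝ := fun ω => Function.update (fun u => V u ω) v 0 with hY
  have hYm : Measurable Y := by
    rw [measurable_pi_iff]
    intro u
    by_cases huv : u = v
    · subst huv
      simp only [hY, Function.update_self]
      exact measurable_const
    · simp only [hY, Function.update_of_ne huv]
      exact hV.measurable_all u
  have hind := hV.indepFun_update hv
  rw [indepFun_iff_map_prod_eq_prod_map_map (hV.measurable v hv).aemeasurable hYm.aemeasurable,
    hV.law v hv] at hind
  set U : ℝ × (Site d → ℝ) → Site d → ℝ := fun a u => V₀ u + g * Function.update a.2 v a.1 u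
    with hU
  have hUupd : ∀ t y, U (t, y) = Function.update (fun u => V₀ u + g * y u) v (V₀ v + g * t) := by
    intro t y
    funext u
    by_cases huv : u = v
    · subst huv; simp [hU]
    · simp [hU, huv]
  have hUc : Continuous U := by
    refine continuous_pi fun u => ?_
    have : Continuous fun a : ℝ × (Site d → ℝ) => Function.update a.2 v a.1 :=
      continuous_snd.update v continuous_fst
    exact continuous_const.add (continuous_const.mul ((continuous_apply u).comp this))
  set S : Set (ℝ × (Site d → ℝ)) := {a | L ≤ ‖green (U a) z v v‖} with hS
  have hSm : MeasurableSet S :=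
    (isClosed_le continuous_const ((continuous_green hz v v).comp hUc).norm).measurableSet
  have hpre : {ω | L ≤ ‖green (fun u => V₀ u + g * V u ω) z v v‖} =
      (fun ω => (V v ω, Y ω)) ⁻¹' S := by
    ext ω
    have : U (V v ω, Y ω) = fun u => V₀ u + g * V u ω := by
      funext u
      simp [hU, hY]
    simp [hS, this]
  have hmeas : Measurable fun ω => (V v ω, Y ω) := (hV.measurable v hv).prodMk hYm
  have : IsProbabilityMeasure (Pr.map Y) := Measure.isProbabilityMeasure_map hYm.aemeasurable
  have : IsProbabilityMeasure μ := by
    rw [← hV.law v hv]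
    exact Measure.isProbabilityMeasure_map (hV.measurable v hv).aemeasurable
  rw [hpre, ← Measure.map_apply hmeas hSm, hind, Measure.prod_apply_symm hSm]
  -- With the other sites frozen, the bad values of `V v` all lie within `2 / (g * L)` of any one of
  -- them, so regularity applies around such a `t₀`.
  have hsec : ∀ y, μ ((fun t => (t, y)) ⁻¹' S) ≤ ENNReal.ofReal (K * (2 / (g * L)) ^ α) := by
    intro y
    rcases Set.eq_empty_or_nonempty ((fun t => (t, y)) ⁻¹' S) with h0 | ⟨t₀, ht₀⟩
    · rw [h0, measure_empty]; exact zero_le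
    refine (measure_mono fun t ht => ?_).trans (hreg (2 / (g * L)) (by positivity) t₀)
    have h1 : L ≤ ‖green (U (t, y)) z v v‖ := ht
    have h2 : L ≤ ‖green (U (t₀, y)) z v v‖ := ht₀
    rw [hUupd] at h1 h2
    have h3 := abs_sub_le_of_le_norm_green _ hz v hL h1 h2
    rw [add_sub_add_left_eq_sub, ← mul_sub, abs_mul, abs_of_pos hg] at h3
    have h4 : |t - t₀| ≤ 2 / (g * L) := by
      rw [le_div_iff₀ (by positivity)]
      rw [le_div_iff₀ hL] at h3
      linarith
    rw [abs_le] at h4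
    exact ⟨by linarith [h4.1], by linarith [h4.2]⟩
  refine (lintegral_mono hsec).trans ?_
  rw [lintegral_const, measure_univ, mul_one]

theorem IsTrimmedPotential.measure_le_abs_le (hV : IsTrimmedPotential Pr Γ μ V)
    {v : Site d} (hv : v ∈ Γ) {q M : ℝ} (hq : 0 < q) (hM : 0 < M) :
    Pr {ω | M ≤ |V v ω|} ≤ (∫⁻ t, ENNReal.ofReal (|t| ^ q) ∂μ) / ENNReal.ofReal (M ^ q) := by
  have hS : MeasurableSet {t : ℝ | M ≤ |t|} := measurableSet_le measurable_const measurable_norm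
  have h1 : Pr {ω | M ≤ |V v ω|} = μ {t : ℝ | M ≤ |t|} := by
    rw [← hV.law v hv, Measure.map_apply (hV.measurable v hv) hS]
    rfl
  rw [h1]
  refine le_trans (measure_mono fun t ht => ?_) (meas_ge_le_lintegral_div (μ := μ)
    (f := fun t => ENNReal.ofReal (|t| ^ q)) ?_ ?_ ENNReal.ofReal_ne_top)
  · exact ENNReal.ofReal_le_ofReal (Real.rpow_le_rpow hM.le ht hq.le)
  · have : Measurable fun t : ℝ => |t| ^ q := by fun_prop
    exact this.ennreal_ofReal.aemeasurable
  · have : 0 < M ^ q := Real.rpow_pos_of_pos hM q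
    simpa using this

/-- With probability at least `1/2`, the potential and the diagonal Green function are not too
large at any site of a finite set. -/
theorem IsTrimmedPotential.half_le_measure_good [IsProbabilityMeasure Pr]
    (hV : IsTrimmedPotential Pr Γ μ V) {V₀ : Site d → ℝ} {g : ℝ} (hg : 0 < g)
    {z : ℂ} (hz : z.im ≠ 0) {K α : ℝ}
    (hreg : ∀ ε > (0 : ℝ), ∀ t : ℝ, μ (Set.Icc (t - ε) (t + ε)) ≤ ENNReal.ofReal (K * ε ^ α))
    {q m : ℝ} (hq : 0 < q) (hm : ∫⁻ t, ENNReal.ofReal (|t| ^ q) ∂μ ≤ ENNReal.ofReal m)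
    {L M : ℝ} (hL : 0 < L) (hM : 0 < M) (B : Finset (Site d))
    (hB1 : (B.card : ℝ) * (m / M ^ q) ≤ 1 / 4)
    (hB2 : (B.card : ℝ) * (K * (2 / (g * L)) ^ α) ≤ 1 / 4) :
    1 / 2 ≤ Pr {ω | ∀ v ∈ B, v ∈ Γ →
        |V v ω| < M ∧ ‖green (fun u => V₀ u + g * V u ω) z v v‖ < L} := by
  classical
  set G := {ω | ∀ v ∈ B, v ∈ Γ →
        |V v ω| < M ∧ ‖green (fun u => V₀ u + g * V u ω) z v v‖ < L} with hG
  have hGm : MeasurableSet G := by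
    rw [hG]
    simp only [Set.ofPred_forall]
    refine MeasurableSet.biInter B.countable_toSet fun v _ => MeasurableSet.iInter fun _ => ?_
    exact (measurableSet_lt (hV.measurable_all v).norm measurable_const).inter
      (measurableSet_lt (hV.measurable_green V₀ g hz v v).norm measurable_const)
  have hMq : 0 < M ^ q := Real.rpow_pos_of_pos hM q
  have hsub : Gᶜ ⊆ ⋃ v ∈ B.filter (fun v => v ∈ Γ), ({ω | M ≤ |V v ω|} ∪
      {ω | L ≤ ‖green (fun u => V₀ u + g * V u ω) z v v‖}) := by
    intro ω hω
    simp only [hG, Set.mem_compl_iff, Set.mem_ofPred_eq, not_forall] at hω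
    obtain ⟨v, hvB, hvΓ, hn⟩ := hω
    simp only [Set.mem_iUnion]
    refine ⟨v, by simp [hvB, hvΓ], ?_⟩
    rw [not_and_or, not_lt, not_lt] at hn
    exact hn
  have hcompl : Pr Gᶜ ≤ 1 / 2 := by
    calc Pr Gᶜ ≤ ∑ v ∈ B.filter (fun v => v ∈ Γ), (ENNReal.ofReal (m / M ^ q) +
          ENNReal.ofReal (K * (2 / (g * L)) ^ α)) := by
          refine (measure_mono hsub).trans ((measure_biUnion_finset_le _ _).trans
            (Finset.sum_le_sum fun v hv => ?_))
          have hvΓ := (Finset.mem_filter.1 hv).2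
          refine (measure_union_le _ _).trans (add_le_add ((hV.measure_le_abs_le hvΓ hq hM).trans ?_)
            (hV.measure_le_norm_green_le hg hz hvΓ hreg hL))
          rw [ENNReal.ofReal_div_of_pos hMq]
          gcongr
      _ ≤ B.card * (ENNReal.ofReal (m / M ^ q) + ENNReal.ofReal (K * (2 / (g * L)) ^ α)) := by
          rw [Finset.sum_const, nsmul_eq_mul]
          gcongr
          exact Finset.filter_subset _ _
      _ ≤ ENNReal.ofReal (1 / 4) + ENNReal.ofReal (1 / 4) := by
          rw [mul_add, ← ENNReal.ofReal_natCast, ← ENNReal.ofReal_mul (by positivity),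
            ← ENNReal.ofReal_mul (by positivity)]
          exact add_le_add (ENNReal.ofReal_le_ofReal hB1) (ENNReal.ofReal_le_ofReal hB2)
      _ = 1 / 2 := by
          rw [← ENNReal.ofReal_add (by norm_num) (by norm_num),
            show (1 / 4 + 1 / 4 : ℝ) = 1 / 2 by norm_num, ENNReal.ofReal_div_of_pos two_pos]
          simp
  have h1 := prob_add_prob_compl hGm (μ := Pr)
  have h2 : (1 : ℝ≥0∞) ≤ Pr G + 1 / 2 :=
    h1.symm.le.trans (add_le_add le_rfl hcompl)
  have h3 : (1 : ℝ≥0∞) - 1 / 2 ≤ Pr G := tsub_le_iff_right.2 h2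
  refine le_trans (le_of_eq ?_) h3
  rw [one_div, ENNReal.one_sub_inv_two]

/-- The site `y` may depend on `ω` with no measurable choice: the sum is moved inside the
expectation, where a single term bounds it below. -/
theorem le_greenMoment (hV : IsTrimmedPotential Pr Γ μ V) {V₀ : Site d → ℝ} {g lam : ℝ}
    {x : Site d} {p ε ρ D : ℝ} (hε : 0 < ε) (hp : 0 ≤ p) (hρ : 0 ≤ ρ) (hD : 0 ≤ D)
    {G : Set Ω} (hG : 1 / 2 ≤ Pr G)
    (h : ∀ ω ∈ G, ∃ y : Site d, D ≤ (dist1 x y : ℝ) ∧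
      ρ ≤ ε * ‖green (fun v => V₀ v + g * V v ω) (lam + ε * Complex.I) x y‖) :
    ENNReal.ofReal (ρ ^ 2 * D ^ p) / 2 ≤ greenMoment Pr V₀ V g lam x p ε := by
  have hz : ((lam : ℂ) + ε * Complex.I).im ≠ 0 := by simp [hε.ne']
  set f : Site d → Ω → ℝ≥0∞ := fun y ω => ENNReal.ofReal (ε ^ 2) *
    ‖green (fun v => V₀ v + g * V v ω) (lam + ε * Complex.I) x y‖ₑ ^ 2 *
      ENNReal.ofReal ((dist1 x y : ℝ) ^ p) with hf
  have hgm : ∀ y, Measurable fun ω =>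
      ‖green (fun v => V₀ v + g * V v ω) (lam + ε * Complex.I) x y‖ₑ ^ 2 := fun y =>
    (hV.measurable_green V₀ g hz x y).enorm.pow_const 2
  have hfm : ∀ y, Measurable (f y) := fun y => ((hgm y).const_mul _).mul_const _
  have e : greenMoment Pr V₀ V g lam x p ε = ∫⁻ ω, ∑' y, f y ω ∂Pr := by
    rw [lintegral_tsum fun y => (hfm y).aemeasurable, greenMoment]
    refine tsum_congr fun y => ?_
    rw [lintegral_mul_const _ ((hgm y).const_mul _), lintegral_const_mul _ (hgm y)]
  rw [e]
  calc ENNReal.ofReal (ρ ^ 2 * D ^ p) / 2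
      ≤ ENNReal.ofReal (ρ ^ 2 * D ^ p) * Pr G := by
        rw [div_eq_mul_one_div]; gcongr
    _ = ∫⁻ _ in G, ENNReal.ofReal (ρ ^ 2 * D ^ p) ∂Pr := by rw [setLIntegral_const]
    _ ≤ ∫⁻ ω in G, ∑' y, f y ω ∂Pr := by
        refine setLIntegral_mono (Measurable.tsum hfm) fun ω hω => ?_
        obtain ⟨y, hy1, hy2⟩ := h ω hω
        refine le_trans ?_ (ENNReal.le_tsum y)
        simp only [hf]
        rw [← ofReal_norm, ← ENNReal.ofReal_pow (norm_nonneg _),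
          ← ENNReal.ofReal_mul (by positivity), ← ENNReal.ofReal_mul (by positivity), ← mul_pow]
        gcongr
    _ ≤ ∫⁻ ω, ∑' y, f y ω ∂Pr := setLIntegral_le_lintegral _ _

end Probability

/-! ### Deterministic lower bound for the Green function in one box -/

theorem norm_boundaryTerm_le {B : Finset (Site d)} {w : Site d → ℂ} {ρ : ℝ} (hρ : 0 ≤ ρ)
    (h : ∀ u ∉ B, ‖w u‖ ≤ ρ) (v : Site d) : ‖boundaryTerm B w v‖ ≤ 2 * d * ρ := by
  have h1 : ∀ u, ‖(if u ∈ B then 0 else w u)‖ ≤ ρ := fun u => by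
    by_cases hu : u ∈ B
    · simpa [hu] using hρ
    · simpa [hu] using h u hu
  refine (norm_sum_le _ _).trans ((Finset.sum_le_card_nsmul _ _ (ρ + ρ) fun i _ =>
    (norm_add_le _ _).trans (add_le_add (h1 _) (h1 _))).trans (le_of_eq ?_))
  simp
  ring

/-- If the spectral projection has a non-negligible entry at `(x, y)`, then the Green function
is not too small either at `y` or somewhere outside of the box. -/
theorem exists_le_norm_green {V₀ W : Site d → ℝ} {B : Finset (Site d)} {lam ε δ κ η M ρ : ℝ}
    (hε : 0 < ε) (hδ : 0 < δ) (hκ : 0 < κ) (hη : 0 ≤ η) (hρ : 0 ≤ ρ)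
    (hgap : ∀ l ∈ spectrum ℂ (restrictOp V₀ B), l ≠ (lam : ℂ) → δ ≤ ‖l - (lam : ℂ)‖)
    (hsupp : ∀ φ : EuclideanSpace ℂ B, ∀ v : B, W v ≠ 0 → spectralProj V₀ B lam φ v = 0)
    (x y : B) (hentry : κ ≤ ‖entry (spectralProj V₀ B lam) x y‖)
    (hM : ∀ v ∈ B, |W v| ≤ M)
    (hgreen : ∀ v ∈ B, W v ≠ 0 →
      ε * ‖green (fun u => V₀ u + W u) (lam + ε * Complex.I) v v‖ ≤ η ^ 2)
    (h1 : δ⁻¹ * (ε + ε * B.card) ≤ κ / 8) (h2 : δ⁻¹ * (B.card * (M * η)) ≤ κ / 8)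
    (h3 : ρ ≤ κ / 8) (h4 : (ε⁻¹ + δ⁻¹) * (B.card * (2 * d * ρ)) ≤ κ / 8) :
    ∃ u : Site d, (u = y ∨ u ∉ B) ∧
      ρ ≤ ε * ‖green (fun u => V₀ u + W u) (lam + ε * Complex.I) x u‖ := by
  set z : ℂ := lam + ε * Complex.I with hz
  set U : Site d → ℝ := fun u => V₀ u + W u with hU
  have him : z.im = ε := by simp [hz]
  have him0 : 0 < z.im := by rw [him]; exact hε
  -- If `w` is below `ρ` at `y` and everywhere outside `B`, the four error terms are at most `κ / 8`
  -- each, giving `κ ≤ κ / 2`.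
  by_contra! hcon
  set w : Site d → ℂ := fun u => (ε : ℂ) * green U z x u with hw
  have hnw : ∀ u, ‖w u‖ = ε * ‖green U z x u‖ := fun u => by
    rw [hw, norm_mul, Complex.norm_real, Real.norm_of_nonneg hε.le]
  have heq : ∀ v : B, formalOp (fun u => V₀ u + W u) w v - (lam + ε * Complex.I) * w v =
      if (x : Site d) = v then (ε : ℂ) else 0 := by
    intro v
    have h := formalOp_green U him0.ne' x v
    have e : w = (ε : ℂ) • fun u => green U z x u := rfl
    rw [← hz, ← hU, e, map_smul, Pi.smul_apply, Pi.smul_apply, smul_eq_mul, smul_eq_mul,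
      mul_left_comm, ← mul_sub, h]
    simp
  have key := hentry.trans (norm_entry_le hε hδ hgap hsupp x y heq)
  have hw1 : ∀ v, ‖w v‖ ≤ 1 := fun v => by
    rw [hnw, ← him]; exact im_mul_norm_green_le U him0 x v
  have hsum : ∀ (f : B → ℝ) (a : ℝ), (∀ v, f v ≤ a) → ∑ v, f v ≤ B.card * a := fun f a hf => by
    simpa using Finset.sum_le_card_nsmul Finset.univ f a fun v _ => hf v
  have hs1 : ∑ v : B, ‖w v‖ ≤ B.card := by
    simpa using hsum (fun v => ‖w v‖) 1 fun v => hw1 v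
  have hs2 : ∑ v : B, ‖(W v : ℂ) * w v‖ ≤ B.card * (M * η) := by
    refine hsum (fun v => ‖(W v : ℂ) * w v‖) _ fun v => ?_
    · have hMv := hM v v.2
      rw [norm_mul, Complex.norm_real, Real.norm_eq_abs]
      by_cases hv : W v = 0
      · rw [hv, abs_zero, zero_mul]
        exact mul_nonneg ((abs_nonneg _).trans hMv) hη
      · refine mul_le_mul hMv ?_ (norm_nonneg _) ((abs_nonneg _).trans hMv)
        refine le_of_sq_le_sq ?_ hη
        -- The Ward bound turns control of the diagonal entry at `v` into `‖w v‖² ≤ η²`, uniformly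
        -- in `x`.
        have hward := mul_le_mul_of_nonneg_left (im_mul_norm_green_sq_le U him0 x v) hε.le
        rw [him] at hward
        rw [hnw, mul_pow]
        have := hgreen v v.2 hv
        linarith
  have hs3 : ∑ v : B, ‖boundaryTerm B w v‖ ≤ B.card * (2 * d * ρ) := by
    have hout : ∀ u ∉ B, ‖w u‖ ≤ ρ := fun u hu => by rw [hnw]; exact (hcon u (Or.inr hu)).le
    exact hsum (fun v => ‖boundaryTerm B w v‖) _ fun v => norm_boundaryTerm_le hρ hout v
  have hy : ‖w y‖ ≤ ρ := by rw [hnw]; exact (hcon y (Or.inl rfl)).le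
  have hε' := inv_pos.2 hε
  have hδ' := inv_pos.2 hδ
  have k1 : ε⁻¹ * ∑ v : B, ‖boundaryTerm B w v‖ ≤ ε⁻¹ * (B.card * (2 * d * ρ)) := by gcongr
  have k2 : δ⁻¹ * (ε + ε * ∑ v : B, ‖w v‖ + ∑ v : B, ‖(W v : ℂ) * w v‖ +
        ∑ v : B, ‖boundaryTerm B w v‖) ≤
      δ⁻¹ * (ε + ε * B.card + B.card * (M * η) + B.card * (2 * d * ρ)) := by gcongr
  linarith

/-! ### Choice of scales and exponents -/

theorem card_le_of_dist1_le {B : Finset (Site d)} {x : Site d} {t : ℝ} (ht : 1 ≤ t)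
    (h : ∀ y ∈ B, (dist1 y x : ℝ) ≤ t) : (B.card : ℝ) ≤ (3 * t) ^ d := by
  set N : ℕ := ⌊t⌋₊
  have hsub : B ⊆ Fintype.piFinset fun i => Finset.Icc (x i - N) (x i + N) := by
    intro y hy
    rw [Fintype.mem_piFinset]
    intro i
    have h1 : dist1 y x ≤ N := Nat.le_floor (h y hy)
    have h2 : (y i - x i).natAbs ≤ dist1 y x :=
      Finset.single_le_sum (f := fun i => (y i - x i).natAbs) (fun _ _ => Nat.zero_le _)
        (Finset.mem_univ i)
    rw [Finset.mem_Icc]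
    omega
  have hcard := Finset.card_le_card hsub
  have e : ∀ i, (Finset.Icc (x i - N) (x i + N)).card = 2 * N + 1 := fun i => by
    rw [Int.card_Icc]; omega
  simp only [Fintype.card_piFinset, e, Finset.prod_const, Finset.card_univ, Fintype.card_fin]
    at hcard
  have hN : (N : ℝ) ≤ t := Nat.floor_le (by linarith)
  calc (B.card : ℝ) ≤ ((2 * N + 1 : ℕ) : ℝ) ^ d := by exact_mod_cast hcard
    _ ≤ (3 * t) ^ d := by
      gcongr
      push_cast
      linarith

/-- Between two consecutive scales there is always one adapted to a given large number. -/
theorem exists_scale {R : ℕ → ℝ} (hmono : Monotone R) (hR : Tendsto R atTop atTop) (n₀ : ℕ)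
    {T : ℝ} (hT : R n₀ ≤ T) : ∃ n, n₀ ≤ n ∧ R n ≤ T ∧ T < R (n + 1) := by
  have hex : ∃ m, T < R m := (hR.eventually (eventually_gt_atTop T)).exists
  classical
  have h1 := Nat.find_spec hex
  have h2 : n₀ < Nat.find hex := by
    by_contra hc
    exact absurd (hmono (not_lt.1 hc)) (not_le.2 (hT.trans_lt h1))
  obtain ⟨k, hk⟩ : ∃ k, Nat.find hex = k + 1 := ⟨Nat.find hex - 1, by omega⟩
  refine ⟨k, by omega, ?_, by rwa [hk] at h1⟩
  exact not_lt.1 (Nat.find_min hex (m := k) (by omega))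

/-- One spare power of `r` absorbs each numerical constant. -/
theorem mul_rpow_le_of_add_le {r a b c : ℝ} (hr : 1 ≤ r) (ha : a ≤ r) (h : b + 1 ≤ c) :
    a * r ^ b ≤ r ^ c := by
  have hr0 : 0 < r := by linarith
  calc a * r ^ b ≤ r * r ^ b := by gcongr
    _ = r ^ (b + 1) := by rw [Real.rpow_add_one hr0.ne', mul_comm]
    _ ≤ r ^ c := Real.rpow_le_rpow_of_exponent_le hr h

/-- The lower bound on the Green function moment obtained from a box at scale `r`, for `ε`
polynomially small in `r`. -/
theorem ofReal_half_le_greenMoment {Ω : Type*} [MeasurableSpace Ω] {Pr : Measure Ω}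
    [IsProbabilityMeasure Pr] {Γ : Set (Site d)} {μ : Measure ℝ} {V : Site d → Ω → ℝ}
    (hV : IsTrimmedPotential Pr Γ μ V) {V₀ : Site d → ℝ} {g : ℝ} (hg : 0 < g) {K α : ℝ}
    (hα : 0 < α)
    (hreg : ∀ ε > (0 : ℝ), ∀ t : ℝ, μ (Set.Icc (t - ε) (t + ε)) ≤ ENNReal.ofReal (K * ε ^ α))
    {q m : ℝ} (hq : 0 < q) (hm0 : 0 ≤ m)
    (hm : ∫⁻ t, ENNReal.ofReal (|t| ^ q) ∂μ ≤ ENNReal.ofReal m)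
    {C c k₁ k₂ k₃ k₄ A p r ε lam : ℝ} (hC : 0 < C) (hc : 0 < c) (hk₁ : k₁ = (C + 1) * d)
    (hk₂ : k₂ = (k₁ + 1) / q) (hk₃ : k₃ = 2 * C + k₁ + k₂ + 1) (hk₄ : k₄ = k₁ + C + 1)
    (hA : A = 2 * k₃ + (k₁ + 1) / α) (hp : (2 * (C * A + k₄) + 1) / min c 1 ≤ p)
    (hr16 : 16 ≤ r) (hrg : 8 * g ≤ r) (hrd : 32 * d ≤ r) (hrm : 4 * m ≤ r)
    (hrK : 4 * (|K| * (2 / g) ^ α) ≤ r)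
    (hε : 0 < ε) (hεA : r ^ A ≤ ε⁻¹) (hεCA : ε⁻¹ ≤ r ^ (C * A))
    {B : Finset (Site d)} {x : Site d}
    (hball : (∀ y, (dist1 y x : ℝ) ≤ r → y ∈ B) ∧ ∀ y ∈ B, (dist1 y x : ℝ) ≤ r ^ C)
    (hentry : ∃ hx : x ∈ B, ∃ y : B, r ^ c ≤ (dist1 x y : ℝ) ∧
      r ^ (-C) ≤ ‖entry (spectralProj V₀ B lam) ⟨x, hx⟩ y‖)
    (hsupp : ∀ φ : EuclideanSpace ℂ B, ∀ v : B, (v : Site d) ∈ Γ → spectralProj V₀ B lam φ v = 0)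
    (hgap : ∀ l ∈ spectrum ℂ (restrictOp V₀ B), l ≠ (lam : ℂ) → r ^ (-C) ≤ ‖l - (lam : ℂ)‖) :
    ENNReal.ofReal r / 2 ≤ greenMoment Pr V₀ V g lam x p ε := by
  -- Roles of the exponents: `|B| ≤ r^k₁`, `|V| < r^k₂` on `Γ ∩ B`, `η = r^(-k₃)` bounds `w` there,
  -- and `ρ = ε r^(-k₄)`. The exponent `A` makes the Wegner level `L = r^(-2k₃) / ε` at least
  -- `r^((k₁+1)/α)`, which beats the union bound over `B`.
  have hr1 : 1 ≤ r := by linarith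
  have hr0 : 0 < r := by linarith
  have hk₁0 : 0 ≤ k₁ := by rw [hk₁]; positivity
  have hk₂0 : 0 ≤ k₂ := by rw [hk₂]; positivity
  have hq₁ : 0 < (k₁ + 1) / α := by positivity
  have hz : ((lam : ℂ) + ε * Complex.I).im ≠ 0 := by simp [hε.ne']
  have hpos : ∀ a : ℝ, 0 < r ^ a := fun a => Real.rpow_pos_of_pos hr0 a
  have hεle : ε ≤ r ^ (-A) := by
    rw [Real.rpow_neg hr0.le]
    exact (le_inv_comm₀ (hpos A) hε).1 hεA
  have hb : (B.card : ℝ) ≤ r ^ k₁ := by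
    refine (card_le_of_dist1_le (Real.one_le_rpow hr1 hC.le) hball.2).trans ?_
    rw [hk₁, Real.rpow_mul_natCast hr0.le]
    have : 3 * r ^ C ≤ r ^ (C + 1) := mul_rpow_le_of_add_le hr1 (by linarith) le_rfl
    gcongr
  have hone : 1 ≤ r ^ k₁ := Real.one_le_rpow hr1 hk₁0
  have hL : 0 < (r ^ (-k₃)) ^ 2 / ε := by have := hpos (-k₃); positivity
  have hB1 : (B.card : ℝ) * (m / (r ^ k₂) ^ q) ≤ 1 / 4 := by
    rw [← Real.rpow_mul hr0.le, hk₂, div_mul_cancel₀ _ hq.ne', Real.rpow_add_one hr0.ne']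
    have h := hpos k₁
    calc (B.card : ℝ) * (m / (r ^ k₁ * r)) ≤ r ^ k₁ * (m / (r ^ k₁ * r)) := by gcongr
      _ = m / r := by field_simp
      _ ≤ 1 / 4 := by rw [div_le_div_iff₀ hr0 (by norm_num)]; linarith
  have hB2 : (B.card : ℝ) * (K * (2 / (g * ((r ^ (-k₃)) ^ 2 / ε))) ^ α) ≤ 1 / 4 := by
    have e1 : 2 / (g * ((r ^ (-k₃)) ^ 2 / ε)) ≤ 2 / g * r ^ (-((k₁ + 1) / α)) := by
      have e2 : r ^ (-((k₁ + 1) / α)) = r ^ (-A) / (r ^ (-k₃)) ^ 2 := by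
        rw [← Real.rpow_mul_natCast hr0.le, ← Real.rpow_sub hr0]
        congr 1
        rw [hA]
        push_cast
        ring
      have h := hpos (-k₃)
      rw [e2]
      calc 2 / (g * ((r ^ (-k₃)) ^ 2 / ε)) = 2 / g * (ε / (r ^ (-k₃)) ^ 2) := by field_simp
        _ ≤ _ := by gcongr
    have h3 : (2 / (g * ((r ^ (-k₃)) ^ 2 / ε))) ^ α ≤ (2 / g) ^ α * (r ^ (k₁ + 1))⁻¹ := by
      have h := hpos (-k₃)
      refine (Real.rpow_le_rpow (by positivity) e1 hα.le).trans (le_of_eq ?_)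
      rw [Real.mul_rpow (by positivity) (hpos _).le, ← Real.rpow_mul hr0.le, neg_mul,
        div_mul_cancel₀ _ hα.ne', Real.rpow_neg hr0.le]
    have h4 : 0 ≤ (2 / (g * ((r ^ (-k₃)) ^ 2 / ε))) ^ α := by
      have h := hpos (-k₃)
      positivity
    have h := hpos k₁
    have h5 : 0 ≤ (2 / g) ^ α := by positivity
    calc (B.card : ℝ) * (K * (2 / (g * ((r ^ (-k₃)) ^ 2 / ε))) ^ α)
        ≤ B.card * (|K| * (2 / (g * ((r ^ (-k₃)) ^ 2 / ε))) ^ α) := by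
          gcongr; exact le_abs_self K
      _ ≤ r ^ k₁ * (|K| * ((2 / g) ^ α * (r ^ (k₁ + 1))⁻¹)) := by gcongr
      _ = |K| * (2 / g) ^ α / r := by
          rw [Real.rpow_add_one hr0.ne']; field_simp
      _ ≤ 1 / 4 := by rw [div_le_div_iff₀ hr0 (by norm_num)]; linarith
  have hgood := hV.half_le_measure_good (V₀ := V₀) hg hz hreg hq hm hL (hpos k₂) B hB1 hB2
  obtain ⟨hx, y, hy, hxy⟩ := hentry
  have hmin : 0 < min c 1 := lt_min hc one_pos
  have hA0 : 0 ≤ A := by linarith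
  have hp0 : 0 ≤ p := le_trans (by have : 0 ≤ C * A := by positivity
                                   have : 0 ≤ k₄ := by linarith
                                   positivity) hp
  have hρ0 : 0 ≤ ε * r ^ (-k₄) := mul_nonneg hε.le (hpos _).le
  have hlow := le_greenMoment hV (V₀ := V₀) (g := g) (lam := lam) (x := x) (p := p)
    (ρ := ε * r ^ (-k₄)) (D := r ^ min c 1) hε hp0 hρ0 (hpos _).le hgood fun ω hω => ?_
  · refine le_trans ?_ hlow
    gcongr
    -- Here `ε` must not be too small: the loss `ρ²` is then at worst `r^(-2(CA + k₄))`, and the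
    -- lower bound on `p` compensates it with one power of `r` to spare.
    have h1 : r ^ (-(C * A + k₄)) ≤ ε * r ^ (-k₄) := by
      rw [neg_add, Real.rpow_add hr0]
      gcongr
      rw [Real.rpow_neg hr0.le]
      exact (inv_le_comm₀ hε (hpos _)).1 hεCA
    calc r = r ^ (1 : ℝ) := (Real.rpow_one r).symm
      _ ≤ r ^ ((-(C * A + k₄)) * (2 : ℕ) + min c 1 * p) := by
        refine Real.rpow_le_rpow_of_exponent_le hr1 ?_
        rw [div_le_iff₀ hmin] at hp
        push_cast
        linarith
      _ = (r ^ (-(C * A + k₄))) ^ 2 * (r ^ min c 1) ^ p := by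
        rw [Real.rpow_add hr0, Real.rpow_mul_natCast hr0.le, Real.rpow_mul hr0.le]
      _ ≤ (ε * r ^ (-k₄)) ^ 2 * (r ^ min c 1) ^ p := by
        have := hpos (-(C * A + k₄))
        gcongr
  · have hWΓ : ∀ v : Site d, g * V v ω ≠ 0 → v ∈ Γ := fun v hv => by
      by_contra hn
      exact hv (by rw [hV.off v hn, mul_zero])
    have hinv : (r ^ (-C))⁻¹ = r ^ C := by rw [Real.rpow_neg hr0.le, inv_inv]
    have hε1 : ε * r ^ C ≤ 1 := by
      calc ε * r ^ C ≤ r ^ (-A) * r ^ C :=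
            mul_le_mul_of_nonneg_right hεle (hpos C).le
        _ = r ^ (-A + C) := (Real.rpow_add hr0 _ _).symm
        _ ≤ 1 := Real.rpow_le_one_of_one_le_of_nonpos hr1 (by linarith)
    have hMV : ∀ v ∈ B, |g * V v ω| ≤ g * r ^ k₂ := by
      intro v hv
      by_cases hvΓ : v ∈ Γ
      · rw [abs_mul, abs_of_pos hg]
        gcongr
        exact (hω v hv hvΓ).1.le
      · rw [hV.off v hvΓ, mul_zero, abs_zero]
        have := hpos k₂
        positivity
    have hgreen : ∀ v ∈ B, g * V v ω ≠ 0 →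
        ε * ‖green (fun u => V₀ u + g * V u ω) (lam + ε * Complex.I) v v‖ ≤ (r ^ (-k₃)) ^ 2 := by
      intro v hv hvW
      have h := (hω v hv (hWΓ v hvW)).2.le
      rw [le_div_iff₀ hε] at h
      linarith
    have hn1 : (r ^ (-C))⁻¹ * (ε + ε * B.card) ≤ r ^ (-C) / 8 := by
      rw [hinv]
      have h : 16 * r ^ (C - A + k₁) ≤ r ^ (-C) := mul_rpow_le_of_add_le hr1 hr16 (by linarith)
      calc r ^ C * (ε + ε * B.card) = r ^ C * (ε * (1 + B.card)) := by ring
        _ ≤ r ^ C * (r ^ (-A) * (r ^ k₁ + r ^ k₁)) := by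
          have := hpos C
          have := hpos (-A)
          gcongr
        _ = 2 * r ^ (C - A + k₁) := by
          rw [Real.rpow_add hr0, sub_eq_add_neg, Real.rpow_add hr0]; ring
        _ ≤ r ^ (-C) / 8 := by linarith
    have hn2 : (r ^ (-C))⁻¹ * (B.card * (g * r ^ k₂ * r ^ (-k₃))) ≤ r ^ (-C) / 8 := by
      rw [hinv]
      have h : (8 * g) * r ^ (C + k₁ + k₂ - k₃) ≤ r ^ (-C) :=
        mul_rpow_le_of_add_le hr1 hrg (by linarith)
      calc r ^ C * (B.card * (g * r ^ k₂ * r ^ (-k₃)))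
          ≤ r ^ C * (r ^ k₁ * (g * r ^ k₂ * r ^ (-k₃))) := by
            have := hpos C
            have := hpos k₂
            have := hpos (-k₃)
            gcongr
        _ = g * r ^ (C + k₁ + k₂ - k₃) := by
          rw [sub_eq_add_neg, Real.rpow_add hr0, Real.rpow_add hr0, Real.rpow_add hr0]; ring
        _ ≤ r ^ (-C) / 8 := by linarith
    have hn3 : ε * r ^ (-k₄) ≤ r ^ (-C) / 8 := by
      have h : 8 * r ^ (-k₄) ≤ r ^ (-C) :=
        mul_rpow_le_of_add_le hr1 (by linarith) (by linarith)
      have hε2 : ε ≤ 1 := hεle.trans (Real.rpow_le_one_of_one_le_of_nonpos hr1 (by linarith))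
      have := mul_le_mul_of_nonneg_right hε2 (hpos (-k₄)).le
      linarith
    have hn4 : (ε⁻¹ + (r ^ (-C))⁻¹) * (B.card * (2 * d * (ε * r ^ (-k₄)))) ≤ r ^ (-C) / 8 := by
      rw [hinv]
      have h : (32 * d) * r ^ (k₁ - k₄) ≤ r ^ (-C) :=
        mul_rpow_le_of_add_le hr1 hrd (by linarith)
      have h' := hpos (-k₄)
      calc (ε⁻¹ + r ^ C) * (B.card * (2 * d * (ε * r ^ (-k₄))))
          = (1 + ε * r ^ C) * (B.card * (2 * d * r ^ (-k₄))) := by field_simp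
        _ ≤ (1 + 1) * (r ^ k₁ * (2 * d * r ^ (-k₄))) := by gcongr
        _ = (4 * d) * r ^ (k₁ - k₄) := by
          rw [sub_eq_add_neg, Real.rpow_add hr0]; ring
        _ ≤ r ^ (-C) / 8 := by linarith
    obtain ⟨u, hu, hge⟩ := exists_le_norm_green (V₀ := V₀) (W := fun v => g * V v ω)
      (κ := r ^ (-C)) (η := r ^ (-k₃)) (M := g * r ^ k₂) (ρ := ε * r ^ (-k₄))
      hε (hpos (-C)) (hpos (-C)) (hpos (-k₃)).le hρ0 hgap
      (fun φ v hv => hsupp φ v (hWΓ v hv)) ⟨x, hx⟩ y hxy hMV hgreen hn1 hn2 hn3 hn4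
    refine ⟨u, ?_, hge⟩
    -- The point `y` is at distance at least `r^c`, a point outside `B` at distance more than `r`;
    -- hence the exponent `min c 1`.
    rcases hu with rfl | hu
    · exact (Real.rpow_le_rpow_of_exponent_le hr1 (min_le_left _ _)).trans hy
    · have h1 : r < dist1 x u := by
        by_contra hn
        exact hu (hball.1 u (by rw [dist1_comm]; exact not_lt.1 hn))
      refine le_trans ?_ h1.le
      exact (Real.rpow_le_rpow_of_exponent_le hr1 (min_le_right _ _)).trans_eq (Real.rpow_one r)

end TrimmedAnderson

/-! ### Matching every small `ε` with a scale -/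

theorem mainTheorem4 {d : ℕ} {Ω : Type*} [MeasurableSpace Ω]
    (Pr : Measure Ω) [IsProbabilityMeasure Pr]
    (Γ : Set (TrimmedAnderson.Site d)) (V₀ : TrimmedAnderson.Site d → ℝ)
    (hper : TrimmedAnderson.IsPeriodic Γ V₀)
    (μ : Measure ℝ) [IsProbabilityMeasure μ]
    (hreg : TrimmedAnderson.IsRegular μ) (hmom : TrimmedAnderson.HasFiniteMoment μ)
    (V : TrimmedAnderson.Site d → Ω → ℝ)
    (hV : TrimmedAnderson.IsTrimmedPotential Pr Γ μ V)
    (g : ℝ) (hg : 0 < g)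
    (hcomp : ∀ K : ((TrimmedAnderson.latticeGraph d).induce Γᶜ).ConnectedComponent,
      K.supp.Finite)
    (lam : ℝ) (x : TrimmedAnderson.Site d)
    (B : ℕ → Finset (TrimmedAnderson.Site d)) (R : ℕ → ℝ) (C c : ℝ) (hC : 0 < C) (hc : 0 < c)
    (hconn : ∀ n, ((TrimmedAnderson.latticeGraph d).induce
      (B n : Set (TrimmedAnderson.Site d))).Connected)
    (hRpos : ∀ n, 0 < R n) (hRtop : Tendsto R atTop atTop)
    (hRgrow : ∀ n, R n < R (n + 1) ∧ R (n + 1) < R n ^ C)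
    (hball : ∀ n, (∀ y, (TrimmedAnderson.dist1 y x : ℝ) ≤ R n → y ∈ B n) ∧
      ∀ y ∈ B n, (TrimmedAnderson.dist1 y x : ℝ) ≤ R n ^ C)
    (hentry : ∀ n, ∃ hx : x ∈ B n, ∃ y : B n,
      R n ^ c ≤ (TrimmedAnderson.dist1 x y : ℝ) ∧
      R n ^ (-C) ≤ ‖TrimmedAnderson.entry (TrimmedAnderson.spectralProj V₀ (B n) lam) ⟨x, hx⟩ y‖)
    (hsupp : ∀ n, ∀ φ : EuclideanSpace ℂ (B n), ∀ v : B n, (v : TrimmedAnderson.Site d) ∈ Γ →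
      TrimmedAnderson.spectralProj V₀ (B n) lam φ v = 0)
    (hgap : ∀ n, ∀ lam' ∈ spectrum ℂ (TrimmedAnderson.restrictOp V₀ (B n)), lam' ≠ (lam : ℂ) →
      R n ^ (-C) ≤ ‖lam' - (lam : ℂ)‖) :
    ∃ p₀ : ℝ, ∀ p : ℝ, p₀ ≤ p →
      Tendsto (fun ε : ℝ => TrimmedAnderson.greenMoment Pr V₀ V g lam x p ε)
        (𝓝[>] (0 : ℝ)) (𝓝 ∞) := by
  obtain ⟨α, hα, K, hreg⟩ := hreg
  obtain ⟨q, hq, hmom⟩ := hmom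
  set m : ℝ := (∫⁻ t, ENNReal.ofReal (|t| ^ q) ∂μ).toReal with hmdef
  have hm : ∫⁻ t, ENNReal.ofReal (|t| ^ q) ∂μ ≤ ENNReal.ofReal m :=
    (ENNReal.ofReal_toReal hmom.ne).ge
  have hm0 : 0 ≤ m := ENNReal.toReal_nonneg
  obtain ⟨k₁, hk₁⟩ : ∃ k₁, k₁ = (C + 1) * (d : ℝ) := ⟨_, rfl⟩
  obtain ⟨k₂, hk₂⟩ : ∃ k₂, k₂ = (k₁ + 1) / q := ⟨_, rfl⟩
  obtain ⟨k₃, hk₃⟩ : ∃ k₃, k₃ = 2 * C + k₁ + k₂ + 1 := ⟨_, rfl⟩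
  obtain ⟨k₄, hk₄⟩ : ∃ k₄, k₄ = k₁ + C + 1 := ⟨_, rfl⟩
  obtain ⟨A, hA⟩ : ∃ A, A = 2 * k₃ + (k₁ + 1) / α := ⟨_, rfl⟩
  have hk₁0 : 0 ≤ k₁ := by rw [hk₁]; positivity
  have hk₂0 : 0 ≤ k₂ := by rw [hk₂]; positivity
  have hA0 : 0 < A := by
    have : 0 < (k₁ + 1) / α := by positivity
    linarith
  refine ⟨(2 * (C * A + k₄) + 1) / min c 1, fun p hp => ?_⟩
  have hmono : Monotone R := monotone_nat_of_le_succ fun n => (hRgrow n).1.le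
  rw [ENNReal.tendsto_nhds_top_iff_nnreal]
  intro T
  -- Each of the first five summands ensures one size condition on `r`; the last gives `r / 2 > T`.
  obtain ⟨n₀, hn₀⟩ := (hRtop.eventually (eventually_ge_atTop
    (16 + 8 * g + 32 * d + 4 * m + 4 * (|K| * (2 / g) ^ α) + 2 * (T + 1)))).exists
  have hRA : Tendsto (fun n => R n ^ A) atTop atTop := (tendsto_rpow_atTop hA0).comp hRtop
  have hRAmono : Monotone fun n => R n ^ A := fun a b hab =>
    Real.rpow_le_rpow (hRpos a).le (hmono hab) hA0.le
  have hev : ∀ᶠ ε : ℝ in 𝓝[>] (0 : ℝ), R n₀ ^ A ≤ ε⁻¹ :=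
    tendsto_inv_nhdsGT_zero.eventually (eventually_ge_atTop _)
  filter_upwards [hev, self_mem_nhdsWithin] with ε hε1 hε
  obtain ⟨n, hn, hlow, hup⟩ := TrimmedAnderson.exists_scale hRAmono hRA n₀ hε1
  have hr := hn₀.trans (hmono hn)
  have hK0 : 0 ≤ 4 * (|K| * (2 / g) ^ α) := by positivity
  have hT0 : (0 : ℝ) ≤ T := T.2
  have hd0 : (0 : ℝ) ≤ d := Nat.cast_nonneg d
  -- The growth condition turns `ε⁻¹ < R (n+1) ^ A` into a bound by a power of `R n` itself, so no
  -- `ε` falls between scales.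
  have hupC : ε⁻¹ ≤ R n ^ (C * A) := by
    rw [Real.rpow_mul (hRpos n).le]
    exact hup.le.trans (Real.rpow_le_rpow (hRpos _).le (hRgrow n).2.le hA0.le)
  refine lt_of_lt_of_le ?_ (TrimmedAnderson.ofReal_half_le_greenMoment hV hg hα hreg hq hm0 hm
    hC hc hk₁ hk₂ hk₃ hk₄ hA hp (by linarith) (by linarith) (by linarith) (by linarith)
    (by linarith) hε hlow hupC (hball n) (hentry n) (hsupp n) (hgap n))
  have h2 : (T : ℝ) < R n / 2 := by linarith
  have h3 : ENNReal.ofReal (R n) / 2 = ENNReal.ofReal (R n / 2) := by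
    rw [ENNReal.ofReal_div_of_pos two_pos]
    simp
  rw [h3, ← ENNReal.ofReal_coe_nnreal]
  exact (ENNReal.ofReal_lt_ofReal_iff (T.2.trans_lt h2)).2 h2
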